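/- Let $G$ be a non-empty finite or countable alphabet with a fixed enumeration, and let $P(g\mid w)\ge 0$, $g\in G$, $w=(w_{-1},w_{-2},\dots)\in G^{-\mathbb N^*}$, satisfy $\sum_{g}P(g\mid w)=1$ for every history $w$. For $k\ge 0$ put $$a_k(g\mid w_{-k}^{-1})=\inf_{z}P(g\mid w_{-1},\dots,w_{-k},z_{-1},z_{-2},\dots),\qquad a_k=\inf_{w_{-1},\dots,w_{-k}}\ \sum_{g\in G}a_k(g\mid w_{-k}^{-1}),\qquad \beta_m=\prod_{k=0}^m a_k .$$ Let $\underline U=(U_i)_{i\in\mathbb Z}$ be i.i.d. uniform on $[0,1[$, on the canonical space $[0,1[^{\mathbb Z}$ with product law $\mathbb P$. For $s\le t\le\infty$, $s$ finite, let $$\tau[s,t]=\max\{m\le s:\ U_k<a_{k-m}\ \text{for all integers } k\in[m,t]\}\in\mathbb Z\cup\{-\infty\}\qquad(\max\emptyset=-\infty).$$ Let $\rho_m$ be the probability that the Markov chain on $\mathbb N$ started at $0$ at time $0$, with transition probabilities $p(x,x+1)=a_x$, $p(x,0)=1-a_x$, is at $0$ at time $m$ (so $\rho_0=1$). Definition of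 $\Phi$. Put $b_0(g)=a_0(g)$ and $b_k(g\mid w_{-k}^{-1})=a_k(g\mid w_{-k}^{-1})-a_{k-1}(g\mid w_{-(k-1)}^{-1})$ for $k\ge1$. For each history $w$ let $B_k(g\mid w_{-k}^{-1})$, $k\ge0$, $g\in G$, be the consecutive intervals, closed on the left and open on the right, starting at $0$, of lengths $b_k(g\mid w_{-k}^{-1})$, ordered by $k$ first and then by $g$ in the enumeration. Fix $g_0\in G$. For $\underline u\in[0,1[^{\mathbb Z}$ and $n\in\mathbb Z$, let $\tau=\tau[n,n](\underline u)$. If $\tau=-\infty$, let $\Phi(\underline u)(n)=g_0$. Otherwise let $\Phi(\underline u)(n)=x_n$, where, recursively for $j=\tau,\dots,n$, $x_j$ is the unique $g\in G$ with $u_j\in[0,a_{j-\tau}[\ \cap\ \bigcup_{0\le\ell\le j-\tau}B_\ell(g\mid x_{j-1},\dots,x_{j-\ell})$. **Theorem.** Assume $\sum_{m\ge0}\beta_m=\infty$. Then, for every enumeration of $G$ and every $g_0\in G$: (i) For all integers $s\le t$, $\mathbb P(\tau[s,t]>-\infty)=1$. (ii) $\Phi:[0,1[^{\mathbb Z}\to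 G^{\mathbb Z}$ is measurable, and the law $\mu$ of $\Phi(\underline U)$ is stationary and compatible with $P$: for all $i\in\mathbb Z$, $g\in G$, $\mu(\eta(i)=g\mid \eta(j),\,j<i)=P(g\mid \eta(i-1),\eta(i-2),\dots)$ for $\mu$-a.e. $\eta$. (iii) For all integers $s\le t$, the restriction of $\Phi(\underline u)$ to $[s,t]$ depends only on the values $u_k$ with $\tau[s,t](\underline u)\le k\le t$: if $v_k=u_k$ for all these $k$, then $\Phi(\underline v)(i)=\Phi(\underline u)(i)$ for all $i\in[s,t]$. (iv) For all integers $s\le t$ and $m\ge0$, $$\mathbb P(s-\tau[s,t]>m)\le\sum_{i=0}^{t-s}\rho_{m+i}.$$ In particular, if $1-a_k\le C r^k$ for all $k$, with some $C$ and some $0<r<1$, then $\rho_k\le C'r'^k$ for all $k$, with some $C'$ and some $0<r'<1$. If $\gamma>1$ and $1-a_k$ is of exact order $k^{-\gamma}$ as $k\to\infty$ (bounded above and below by positive multiples of $k^{-\gamma}$ for all large $k$; in particular if $1-a_k\sim k^{-\gamma}$), then $\rho_k$ is of exact order $k^{-\gamma}$ too. (v) If $\beta=\lim_{m\to\infty}\beta_m>0$,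 then (i), (iii) and (iv) hold also for $t=\infty$: for all $s\in\mathbb Z$ and $m\ge0$, $\mathbb P(\tau[s,\infty]>-\infty)=1$; if $v_k=u_k$ for all $k\ge\tau[s,\infty](\underline u)$, then $\Phi(\underline v)(i)=\Phi(\underline u)(i)$ for all $i\ge s$; and $\mathbb P(s-\tau[s,\infty]>m)\le\sum_{i\ge0}\rho_{m+i}$, where this series converges. -/

import Mathlib

open MeasureTheory Filter Topology Asymptotics

noncomputable section

/-- A probability transition kernel `P(g | w)` on the alphabet `G`, defined for *all* histories.
A history `w_{-1}, w_{-2}, …` is coded as `w : ℕ → G`, where `w j` is the symbol `w_{-(j+1)}`. -/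
structure TransitionKernel (G : Type*) where
  prob : G → (ℕ → G) → ℝ
  prob_nonneg : ∀ g w, 0 ≤ prob g w
  hasSum_prob : ∀ w, HasSum (fun g => prob g w) 1

/-- The history `(w_{-1}, …, w_{-k}, z_{-1}, z_{-2}, …)`. -/
def concatHistory {G : Type*} (k : ℕ) (w z : ℕ → G) : ℕ → G :=
  fun i => if i < k then w i else z (i - k)

/-- The uniform distribution (Lebesgue measure) on `[0,1[`. -/
def uniformIco : Measure (Set.Ico (0 : ℝ) 1) :=
  (volume : Measure ℝ).comap Subtype.val

instance isProbabilityMeasure_uniformIco : IsProbabilityMeasure uniformIco where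
  measure_univ := by
    rw [uniformIco, comap_subtype_coe_apply measurableSet_Ico, Set.image_univ,
      Subtype.range_coe, Real.volume_Ico]
    simp

/-- The law of a sequence `(U_i)_{i ∈ ℤ}` of independent variables, uniform on `[0,1[`,
on the canonical space `[0,1[^ℤ`. -/
def uniformSeqLaw : Measure (ℤ → Set.Ico (0 : ℝ) 1) :=
  Measure.infinitePi (fun _ : ℤ => uniformIco)

/-- The history `η(i-1), η(i-2), …` of `η ∈ G^ℤ` before time `i`. -/
def pastAt {G : Type*} (i : ℤ) (η : ℤ → G) : ℕ → G := fun j => η (i - 1 - j)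

/-- `ν` is invariant under all the shifts of `ℤ`. -/
def IsStationaryLaw {G : Type*} [MeasurableSpace G] (ν : Measure (ℤ → G)) : Prop :=
  ∀ k : ℤ, ν.map (fun η i => η (i + k)) = ν

/-- Transition probabilities of the house-of-cards chain on `ℕ`:
`p(x, x+1) = a_x`, `p(x, 0) = 1 - a_x`, and `p(x, y) = 0` otherwise. -/
def houseOfCards (a : ℕ → ℝ) (x y : ℕ) : ℝ :=
  if y = x + 1 then a x else if y = 0 then 1 - a x else 0

/-- Law at time `n` of the house-of-cards chain started from the origin at time `0`. -/
def houseOfCardsLaw (a : ℕ → ℝ) : ℕ → ℕ → ℝ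
  | 0, y => if y = 0 then 1 else 0
  | n + 1, y => ∑' x, houseOfCardsLaw a n x * houseOfCards a x y

namespace TransitionKernel

variable {G : Type*} (P : TransitionKernel G)

/-- A probability measure `ν` on `G^ℤ` is compatible with `P`: for all `i` and `g`,
`P(g | η(i-1), η(i-2), …)` is a version of the conditional probability of `{η(i) = g}` given the
σ-algebra generated by the coordinates `η(j)`, `j < i`. -/
def Compatible [MeasurableSpace G] (ν : Measure (ℤ → G)) : Prop :=
  IsProbabilityMeasure ν ∧
  ∀ (i : ℤ) (g : G),
    ν[Set.indicator {η : ℤ → G | η i = g} (fun _ => (1 : ℝ)) |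
        MeasurableSpace.comap (pastAt i) inferInstance]
      =ᵐ[ν] fun η => P.prob g (pastAt i η)

/-- `a_k(g | w_{-1}, …, w_{-k})`; it only reads the first `k` symbols of `w`. -/
def aCond (k : ℕ) (g : G) (w : ℕ → G) : ℝ :=
  ⨅ z : ℕ → G, P.prob g (concatHistory k w z)

/-- `a_k`, the infimum over `w_{-1}, …, w_{-k}` of `∑_g a_k(g | w_{-1}, …, w_{-k})`. -/
def a (k : ℕ) : ℝ := ⨅ w : ℕ → G, ∑' g, P.aCond k g w

/-- `β_m = a_0 a_1 ⋯ a_m`. -/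
def betaProd (m : ℕ) : ℝ := ∏ k ∈ Finset.range (m + 1), P.a k

/-- `ρ_m`, the probability that the house-of-cards chain is at the origin at time `m`. -/
def rho (m : ℕ) : ℝ := houseOfCardsLaw P.a m 0

/-- The set of all `m ≤ s` such that `u_k < a_{k-m}` for all integers `k ∈ [m,t]`
(where `t` may be `∞`). -/
def regenSet (u : ℤ → Set.Ico (0 : ℝ) 1) (s : ℤ) (t : WithTop ℤ) : Set ℤ :=
  {m | m ≤ s ∧ ∀ k : ℤ, m ≤ k → (k : WithTop ℤ) ≤ t → (u k : ℝ) < P.a (k - m).toNat}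

open Classical in
/-- The regeneration time `τ[s,t]`: the maximum of `regenSet` (which is bounded above by `s`),
and `-∞`, written `⊥`, if that set is empty. -/
def tau (u : ℤ → Set.Ico (0 : ℝ) 1) (s : ℤ) (t : WithTop ℤ) : WithBot ℤ :=
  if (P.regenSet u s t).Nonempty then ((sSup (P.regenSet u s t) : ℤ) : WithBot ℤ) else ⊥

/-- `a_{k-1}(g | w_{-1}, …, w_{-(k-1)})`, with the convention `a_{-1} = 0`. -/
def aCondPred (k : ℕ) (g : G) (w : ℕ → G) : ℝ :=
  match k with
  | 0 => 0
  | k + 1 => P.aCond k g w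

/-- `b_k(g | w_{-1}, …, w_{-k})`. -/
def b (k : ℕ) (g : G) (w : ℕ → G) : ℝ := P.aCond k g w - P.aCondPred k g w

/-- Left end point of `B_k(g | w)`: the total length of all the `B_ℓ(g' | w)` with `ℓ < k`, which is
`∑_{g'} a_{k-1}(g' | w)`, plus that of the `B_k(g' | w)` with `g'` before `g` in the
enumeration `e` of the alphabet. -/
def leftEnd (e : G ↪ ℕ) (k : ℕ) (g : G) (w : ℕ → G) : ℝ :=
  (∑' g', P.aCondPred k g' w) + ∑' g', if e g' < e g then P.b k g' w else 0

/-- The interval `B_k(g | w_{-1}, …, w_{-k})`. For a given `w` these intervals are consecutive, start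
at the origin, and are ordered by `k` first and by `g` next. -/
def B (e : G ↪ ℕ) (k : ℕ) (g : G) (w : ℕ → G) : Set ℝ :=
  Set.Ico (P.leftEnd e k g w) (P.leftEnd e k g w + P.b k g w)

/-- `B_{ℓ,k}(g | w_{-1}, …, w_{-k})`, which is `[0,a_k[ ∩ B_ℓ(g | w_{-1}, …, w_{-ℓ})`. -/
def BTrunc (e : G ↪ ℕ) (l k : ℕ) (g : G) (w : ℕ → G) : Set ℝ :=
  Set.Ico 0 (P.a k) ∩ P.B e l g w

open Classical in
/-- The letter `g` with `x ∈ ⋃_{ℓ ≤ k} B_{ℓ,k}(g | w_{-1}, …, w_{-k})` (there is exactly one if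
`0 ≤ x < a_k`; the value `g₀` is used if there is none). -/
def letter (e : G ↪ ℕ) (g₀ : G) (k : ℕ) (x : ℝ) (w : ℕ → G) : G :=
  if h : ∃ g, ∃ l ≤ k, x ∈ P.BTrunc e l k g w then h.choose else g₀

/-- The history at time `m + n`, that is `(x_{m+n-1}, …, x_m)`, produced by the recursion started at
time `m`, in which `x_{m+n} = letter n u_{m+n} (x_{m+n-1}, …, x_m)`. The symbols before time `m` are
never read and are filled in with `g₀`. -/
def runFrom (e : G ↪ ℕ) (g₀ : G) (u : ℤ → Set.Ico (0 : ℝ) 1) (m : ℤ) : ℕ → ℕ → G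
  | 0 => fun _ => g₀
  | n + 1 => fun i =>
      match i with
      | 0 => P.letter e g₀ n (u (m + n)) (runFrom e g₀ u m n)
      | i + 1 => runFrom e g₀ u m n i

/-- The map `Φ : [0,1[^ℤ → G^ℤ`: its component at `n` is the symbol at time `n` of the recursion
started at time `τ[n] = τ[n,n]`, and is `g₀` if `τ[n] = -∞`. -/
def Phi (e : G ↪ ℕ) (g₀ : G) (u : ℤ → Set.Ico (0 : ℝ) 1) : ℤ → G := fun n =>
  match P.tau u n (n : WithTop ℤ) with
  | ⊥ => g₀
  | (m : ℤ) => P.letter e g₀ (n - m).toNat (u n) (P.runFrom e g₀ u m (n - m).toNat)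

end TransitionKernel

end

/-! The symbol at time `n` is read off from `u n` by stacked intervals: if `u n < a k`, the point
lies in a layer of index at most `k` whatever the history, so the draw needs at most `k` past
symbols. Hence a time `m` in `regenSet` starts a recursion that never looks before `m`, and the
recursions started at two such times agree from the later one on (`runLetter_add`). So `Phi` can be
computed from any regeneration time and not only the last (`Phi_eq_of_mem`). This gives shift
equivariance, and it shows that the memory of the recursion is the true past of `Phi`
(`runFrom_eq_pastAt`); locality, (iii), holds because the last regeneration time is itself found by
looking no further back than any known one.

Compatibility: the past of `Phi` before `n` is a function of the coordinates before `n`, hence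
independent of `u n`. Almost surely, `Phi` takes the value `g` at `n` exactly when `u n` falls in
the union over `l` of the `B_l(g | past)`. The length of this union telescopes to `P(g | past)`
because `a k → 1`, which the divergence of the sum of the `β_m` forces. Fubini concludes.

Regeneration times exist because of the house-of-cards chain driven by the same uniforms from time
`s - m`. If it avoids `0` throughout `[s, t]`, the instant after its last zero before `s` is a
regeneration time (`exists_mem_regenSet`); a union bound gives the tail estimate with the `ρ_{m+i}`.
Splitting at the last zero gives `∑ climbProb k * ρ_{n-k} = 1`. A monotone coupling makes `ρ`
nonincreasing, so `ρ_n * ∑_{k ≤ n} climbProb k ≤ 1` and `ρ_n → 0`. If the climbing probabilities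
stay above some `β > 0`, the same identity bounds `∑ ρ` by `1 / β`, whence (v). The decay rates come
from the renewal equation, whose first-return law then has mass at most `1 - β < 1`. -/

noncomputable section

/-! ### Renewal theory of the house-of-cards chain -/

section Renewal

/-- The probability that the house-of-cards chain climbs from `0` to `k` without falling. -/
def climbProb (a : ℕ → ℝ) (k : ℕ) : ℝ := ∏ x ∈ Finset.range k, a x

/-- The probability that the house-of-cards chain first returns to `0` at time `k + 1`. -/
def fallProb (a : ℕ → ℝ) (k : ℕ) : ℝ := climbProb a k * (1 - a k)

lemma climbProb_succ (a : ℕ → ℝ) (k : ℕ) : climbProb a (k + 1) = climbProb a k * a k := by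
  simp [climbProb, Finset.prod_range_succ]

lemma fallProb_eq_sub (a : ℕ → ℝ) (k : ℕ) : fallProb a k = climbProb a k - climbProb a (k + 1) := by
  rw [fallProb, climbProb_succ]; ring

lemma houseOfCardsLaw_of_lt (a : ℕ → ℝ) (n y : ℕ) (h : n < y) : houseOfCardsLaw a n y = 0 := by
  induction n generalizing y with
  | zero => simp [houseOfCardsLaw, show y ≠ 0 by omega]
  | succ n ih =>
    rw [houseOfCardsLaw]
    refine (tsum_congr fun x => ?_).trans tsum_zero
    by_cases hx : n < x
    · simp [ih x hx]
    · simp [houseOfCards, show y ≠ x + 1 by omega, show y ≠ 0 by omega]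

lemma houseOfCardsLaw_succ_succ (a : ℕ → ℝ) (n y : ℕ) :
    houseOfCardsLaw a (n + 1) (y + 1) = houseOfCardsLaw a n y * a y := by
  rw [houseOfCardsLaw, tsum_eq_single y]
  · simp [houseOfCards]
  · intro x hx
    simp [houseOfCards, Ne.symm hx]

lemma houseOfCardsLaw_succ_zero (a : ℕ → ℝ) (n : ℕ) :
    houseOfCardsLaw a (n + 1) 0 =
      ∑ x ∈ Finset.range (n + 1), houseOfCardsLaw a n x * (1 - a x) := by
  rw [houseOfCardsLaw, tsum_eq_sum (s := Finset.range (n + 1))]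
  · simp [houseOfCards]
  · intro x hx
    rw [houseOfCardsLaw_of_lt a n x (by simpa using hx), zero_mul]

lemma houseOfCardsLaw_add (a : ℕ → ℝ) (n y : ℕ) :
    houseOfCardsLaw a (n + y) y = climbProb a y * houseOfCardsLaw a n 0 := by
  induction y with
  | zero => simp [climbProb]
  | succ y ih => rw [← add_assoc, houseOfCardsLaw_succ_succ, ih, climbProb_succ]; ring

lemma houseOfCardsLaw_of_le (a : ℕ → ℝ) {n y : ℕ} (h : y ≤ n) :
    houseOfCardsLaw a n y = climbProb a y * houseOfCardsLaw a (n - y) 0 := by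
  rw [← houseOfCardsLaw_add, Nat.sub_add_cancel h]

lemma sum_houseOfCardsLaw (a : ℕ → ℝ) (n : ℕ) :
    ∑ y ∈ Finset.range (n + 1), houseOfCardsLaw a n y = 1 := by
  induction n with
  | zero => simp [houseOfCardsLaw]
  | succ n ih =>
    rw [Finset.sum_range_succ', houseOfCardsLaw_succ_zero, ← Finset.sum_add_distrib]
    refine (Finset.sum_congr rfl fun y _ => ?_).trans ih
    rw [houseOfCardsLaw_succ_succ]; ring

lemma houseOfCardsLaw_zero_zero (a : ℕ → ℝ) : houseOfCardsLaw a 0 0 = 1 := by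
  simp [houseOfCardsLaw]

/-- Decomposition according to the last visit to the origin. -/
lemma sum_climbProb_mul (a : ℕ → ℝ) (n : ℕ) :
    ∑ k ∈ Finset.range (n + 1), climbProb a k * houseOfCardsLaw a (n - k) 0 = 1 := by
  refine (Finset.sum_congr rfl fun y hy => ?_).trans (sum_houseOfCardsLaw a n)
  exact (houseOfCardsLaw_of_le a (by simpa [Nat.lt_succ_iff] using hy)).symm

/-- The renewal equation. -/
lemma houseOfCardsLaw_renewal (a : ℕ → ℝ) (n : ℕ) :
    houseOfCardsLaw a (n + 1) 0 =
      ∑ k ∈ Finset.range (n + 1), fallProb a k * houseOfCardsLaw a (n - k) 0 := by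
  rw [houseOfCardsLaw_succ_zero]
  refine Finset.sum_congr rfl fun y hy => ?_
  rw [houseOfCardsLaw_of_le a (by simpa [Nat.lt_succ_iff] using hy), fallProb]; ring

variable {a : ℕ → ℝ} (h0 : ∀ k, 0 ≤ a k) (h1 : ∀ k, a k ≤ 1)

include h0 in
lemma climbProb_nonneg (k : ℕ) : 0 ≤ climbProb a k := Finset.prod_nonneg fun _ _ => h0 _

include h0 h1 in
lemma climbProb_le_one (k : ℕ) : climbProb a k ≤ 1 :=
  Finset.prod_le_one (fun _ _ => h0 _) fun _ _ => h1 _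

include h0 h1 in
lemma fallProb_nonneg (k : ℕ) : 0 ≤ fallProb a k :=
  mul_nonneg (climbProb_nonneg h0 k) (sub_nonneg.2 (h1 k))

include h0 h1 in
lemma fallProb_le (k : ℕ) : fallProb a k ≤ 1 - a k :=
  mul_le_of_le_one_left (sub_nonneg.2 (h1 k)) (climbProb_le_one h0 h1 k)

lemma sum_fallProb (a : ℕ → ℝ) (n : ℕ) :
    ∑ k ∈ Finset.range n, fallProb a k = 1 - climbProb a n := by
  simp_rw [fallProb_eq_sub, Finset.sum_range_sub', climbProb, Finset.range_zero, Finset.prod_empty]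

include h0 h1 in
lemma houseOfCardsLaw_nonneg (n y : ℕ) : 0 ≤ houseOfCardsLaw a n y := by
  induction n generalizing y with
  | zero => simp only [houseOfCardsLaw]; split_ifs <;> norm_num
  | succ n ih =>
    refine tsum_nonneg fun x => mul_nonneg (ih x) ?_
    unfold houseOfCards
    split_ifs
    exacts [h0 x, sub_nonneg.2 (h1 x), le_rfl]

include h0 h1 in
-- Replace every climbing probability in `sum_climbProb_mul` by its lower bound `β`.
lemma sum_returnProb_le {β : ℝ} (hβ : 0 < β) (h : ∀ k, β ≤ climbProb a k) (n : ℕ) :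
    ∑ k ∈ Finset.range n, houseOfCardsLaw a k 0 ≤ 1 / β := by
  rw [le_div_iff₀ hβ]
  rcases n with _ | n
  · simp
  rw [← sum_climbProb_mul a n, Finset.sum_mul, ← Finset.sum_range_reflect]
  refine Finset.sum_le_sum fun k hk => ?_
  rw [mul_comm]
  exact mul_le_mul_of_nonneg_right (h k) (houseOfCardsLaw_nonneg h0 h1 _ _)

include h0 h1 in
lemma summable_returnProb {β : ℝ} (hβ : 0 < β) (h : ∀ k, β ≤ climbProb a k) :
    Summable fun n => houseOfCardsLaw a n 0 :=
  summable_of_sum_range_le (fun n => houseOfCardsLaw_nonneg h0 h1 n 0)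
    (sum_returnProb_le h0 h1 hβ h)

include h0 h1 in
-- Monotonicity replaces any limit theorem for renewal sequences: in `sum_climbProb_mul` each
-- `ρ_{n-k}` is at least `ρ_n`, so `ρ_n` is at most the inverse of a divergent sum.
lemma tendsto_returnProb_zero (hanti : Antitone fun n => houseOfCardsLaw a n 0)
    (hsum : Tendsto (fun n => ∑ k ∈ Finset.range n, climbProb a k) atTop atTop) :
    Tendsto (fun n => houseOfCardsLaw a n 0) atTop (𝓝 0) := by
  have hnn := fun n => houseOfCardsLaw_nonneg h0 h1 n 0
  refine squeeze_zero (g := fun n => 1 / ∑ k ∈ Finset.range (n + 1), climbProb a k) hnn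
    (fun n => ?_) ?_
  · have hpos : 0 < ∑ k ∈ Finset.range (n + 1), climbProb a k := by
      rw [Finset.sum_range_succ']
      have := Finset.sum_nonneg (s := Finset.range n) fun k _ => climbProb_nonneg h0 (k + 1)
      simp [climbProb] at this ⊢
      linarith
    rw [le_div_iff₀ hpos, ← sum_climbProb_mul a n, Finset.mul_sum]
    refine Finset.sum_le_sum fun k hk => ?_
    rw [mul_comm]
    exact mul_le_mul_of_nonneg_left (hanti (Nat.sub_le n k)) (climbProb_nonneg h0 k)
  · simp_rw [one_div]
    exact tendsto_inv_atTop_zero.comp (hsum.comp (tendsto_add_atTop_nat 1))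

/-- The climbing probabilities are bounded below if `∑ (1 - a k)` converges. -/
lemma exists_le_climbProb (hpos : ∀ k, 0 < a k) (h1 : ∀ k, a k ≤ 1)
    (hs : Summable fun k => 1 - a k) : ∃ β, 0 < β ∧ ∀ k, β ≤ climbProb a k := by
  have h0 := fun k => (hpos k).le
  -- Beyond `N`, the inequality `∏ (1 - x) ≥ 1 - ∑ x` keeps the product above `1 / 2`; the first `N`
  -- factors contribute a positive constant.
  obtain ⟨N, hN⟩ : ∃ N, ∀ m, ∑ k ∈ Finset.range m, (1 - a (N + k)) ≤ 1 / 2 := by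
    have ht := tendsto_sum_nat_add fun k => 1 - a k
    obtain ⟨N, hN⟩ := (ht.eventually (gt_mem_nhds (show (0 : ℝ) < 1 / 2 by norm_num))).exists
    refine ⟨N, fun m => le_trans ?_ hN.le⟩
    simp_rw [add_comm N]
    exact ((summable_nat_add_iff N).2 hs).sum_le_tsum _ fun k _ => sub_nonneg.2 (h1 _)
  have hNpos : 0 < climbProb a N := Finset.prod_pos fun k _ => hpos k
  have key : ∀ m, 1 - ∑ k ∈ Finset.range m, (1 - a (N + k)) ≤ ∏ k ∈ Finset.range m, a (N + k) := by
    intro m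
    induction m with
    | zero => simp
    | succ m ih =>
      rw [Finset.sum_range_succ, Finset.prod_range_succ]
      have hp : ∏ k ∈ Finset.range m, a (N + k) ≤ 1 :=
        Finset.prod_le_one (fun _ _ => h0 _) fun _ _ => h1 _
      nlinarith [h1 (N + m)]
  have hanti : Antitone (climbProb a) := antitone_nat_of_succ_le fun k => by
    rw [climbProb_succ]; exact mul_le_of_le_one_right (climbProb_nonneg h0 k) (h1 k)
  refine ⟨climbProb a N * (1 / 2), by positivity, fun k => ?_⟩
  refine le_trans ?_ (hanti (Nat.le_add_left k N))
  rw [climbProb, climbProb, Finset.prod_range_add]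
  exact mul_le_mul_of_nonneg_left (by linarith [key k, hN k]) hNpos.le

include h1 in
/-- Geometric decay of the return probabilities. -/
lemma returnProb_le_geometric (hpos : ∀ k, 0 < a k)
    {C r : ℝ} (hr0 : 0 < r) (hr1 : r < 1) (h : ∀ k, 1 - a k ≤ C * r ^ k) :
    ∃ C r : ℝ, 0 < r ∧ r < 1 ∧ ∀ k, houseOfCardsLaw a k 0 ≤ C * r ^ k := by
  have h0 := fun k => (hpos k).le
  have hC : 0 ≤ C := by have := h 0; have := h1 0; simp at *; linarith
  have hs : Summable fun k => 1 - a k :=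
    Summable.of_nonneg_of_le (fun k => sub_nonneg.2 (h1 k)) h
      ((summable_geometric_of_lt_one hr0.le hr1).mul_left C)
  obtain ⟨β, hβ, hβk⟩ := exists_le_climbProb hpos h1 hs
  have hf0 := fallProb_nonneg h0 h1
  have hF : ∑' k, fallProb a k ≤ 1 - β :=
    Real.tsum_le_of_sum_range_le hf0 fun n => by rw [sum_fallProb]; linarith [hβk n]
  -- With `1 < s₀ < r⁻¹`, the generating function `∑ f_k s^(k+1)` of the return times converges
  -- uniformly on `[1, s₀]`. Its value at `1` is at most `1 - β`, so by continuity it is still below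
  -- `1` at some `s > 1`; the renewal equation then propagates `ρ_n s^n ≤ 1`.
  obtain ⟨s₀, hs₀, hs₀r⟩ := exists_between ((one_lt_inv₀ hr0).2 hr1)
  have hrs : r * s₀ < 1 := by
    have := mul_lt_mul_of_pos_left hs₀r hr0
    rwa [mul_inv_cancel₀ hr0.ne'] at this
  have hbound : ∀ k, ∀ s ∈ Set.Icc 1 s₀, ‖fallProb a k * s ^ (k + 1)‖ ≤ C * s₀ * (r * s₀) ^ k := by
    intro k s hs
    have hs0 : (0 : ℝ) ≤ s := by linarith [hs.1]
    rw [Real.norm_of_nonneg (mul_nonneg (hf0 k) (pow_nonneg hs0 _))]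
    calc fallProb a k * s ^ (k + 1) ≤ (C * r ^ k) * s₀ ^ (k + 1) :=
          mul_le_mul ((fallProb_le h0 h1 k).trans (h k)) (pow_le_pow_left₀ hs0 hs.2 _)
            (pow_nonneg hs0 _) (by positivity)
      _ = _ := by rw [mul_pow, pow_succ]; ring
  have hsumm : Summable fun k : ℕ => C * s₀ * (r * s₀) ^ k :=
    (summable_geometric_of_lt_one (by positivity) hrs).mul_left _
  have hcont : ContinuousOn (fun s => ∑' k, fallProb a k * s ^ (k + 1)) (Set.Icc 1 s₀) :=
    continuousOn_tsum (fun k => by fun_prop) hsumm hbound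
  obtain ⟨s, hs1, hss₀, hslt⟩ :
      ∃ s, 1 < s ∧ s ≤ s₀ ∧ ∑' k, fallProb a k * s ^ (k + 1) < 1 := by
    have hc := (hcont 1 ⟨le_rfl, hs₀.le⟩).mono_left
      (nhdsWithin_mono _ (Set.Ioc_subset_Icc_self (a := (1 : ℝ)) (b := s₀)))
    have hev := hc.eventually (gt_mem_nhds (show _ < (1 : ℝ) by simp; linarith))
    have : (𝓝[Set.Ioc 1 s₀] (1 : ℝ)).NeBot := by
      rw [nhdsWithin_Ioc_eq_nhdsGT hs₀]; infer_instance
    obtain ⟨s, hs, hs'⟩ := (hev.and self_mem_nhdsWithin).exists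
    exact ⟨s, hs'.1, hs'.2, hs⟩
  have hsp : 0 < s := by linarith
  have hpart : ∀ n, ∑ k ∈ Finset.range n, fallProb a k * s ^ (k + 1) ≤ 1 := fun n =>
    ((Summable.of_norm_bounded hsumm fun k => hbound k s ⟨hs1.le, hss₀⟩).sum_le_tsum _
      fun k _ => mul_nonneg (hf0 k) (by positivity)).trans hslt.le
  have key : ∀ n, houseOfCardsLaw a n 0 * s ^ n ≤ 1 := by
    intro n
    induction n using Nat.strong_induction_on with
    | _ n ih =>
      rcases n with _ | n
      · simp [houseOfCardsLaw]
      · rw [houseOfCardsLaw_renewal, Finset.sum_mul]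
        refine le_trans (Finset.sum_le_sum fun k hk => ?_) (hpart (n + 1))
        have hkn : k ≤ n := by simpa [Nat.lt_succ_iff] using hk
        calc fallProb a k * houseOfCardsLaw a (n - k) 0 * s ^ (n + 1)
            = fallProb a k * s ^ (k + 1) * (houseOfCardsLaw a (n - k) 0 * s ^ (n - k)) := by
              rw [show n + 1 = (k + 1) + (n - k) by omega, pow_add]
              ring
          _ ≤ _ := mul_le_of_le_one_right (mul_nonneg (hf0 k) (by positivity)) (ih _ (by omega))
  refine ⟨1, s⁻¹, by positivity, inv_lt_one_of_one_lt₀ hs1, fun k => ?_⟩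
  rw [one_mul, inv_pow, ← one_div, le_div_iff₀ (by positivity)]
  exact key k

/-- The shifted weight never vanishes, not even at `k = 0`, so asymptotic bounds against it become
bounds for all `k`. -/
lemma isTheta_rpow_add_one (γ : ℝ) :
    (fun k : ℕ => ((k : ℝ) + 1) ^ (-γ)) =Θ[atTop] fun k : ℕ => (k : ℝ) ^ (-γ) := by
  have h : (fun k : ℕ => (k : ℝ) + 1) ~[atTop] fun k : ℕ => (k : ℝ) := by
    refine IsEquivalent.add_isLittleO IsEquivalent.refl ?_
    exact isLittleO_const_left.2 (Or.inr (by
      simpa [Function.comp_def] using tendsto_natCast_atTop_atTop (R := ℝ)))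
  exact (h.rpow fun k => by simp).isTheta

include h1 in
/-- Polynomial decay of the return probabilities, from above. -/
lemma returnProb_le_polynomial (h0 : ∀ k, 0 ≤ a k) {β : ℝ} (hβ : 0 < β)
    (hβk : ∀ k, β ≤ climbProb a k) {γ : ℝ} (hγ : 0 < γ) {D : ℝ}
    (hD : ∀ k : ℕ, fallProb a k * ((k : ℝ) + 1) ^ γ ≤ D) :
    ∃ M : ℝ, ∀ n : ℕ, houseOfCardsLaw a n 0 * ((n : ℝ) + 1) ^ γ ≤ M := by
  have hf0 := fallProb_nonneg h0 h1
  have hr0 := fun n => houseOfCardsLaw_nonneg h0 h1 n 0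
  have hD0 : 0 ≤ D := (mul_nonneg (hf0 0) (by positivity)).trans (hD 0)
  have hβ1 : β ≤ 1 := by simpa [climbProb] using hβk 0
  -- The mass `1 - β` of the first-return law leaves room for the loss `(1 - δ) ^ (-γ)` incurred
  -- when the weight at `n + 1` is compared with that at `n - k`.
  obtain ⟨δ, hδ0, hδ1, hδ⟩ :
      ∃ δ : ℝ, 0 < δ ∧ δ < 1 ∧ (1 - β) * (1 - δ) ^ (-γ) < 1 := by
    have hc : ContinuousAt (fun δ : ℝ => (1 - β) * (1 - δ) ^ (-γ)) 0 := by
      refine continuousAt_const.mul (ContinuousAt.rpow_const (by fun_prop) (Or.inl (by simp)))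
    have hev := hc.eventually (gt_mem_nhds (show _ < (1 : ℝ) by simp; linarith))
    obtain ⟨δ, h, h'⟩ := ((hev.filter_mono nhdsWithin_le_nhds).and
      (Ioo_mem_nhdsGT (zero_lt_one (α := ℝ)))).exists
    exact ⟨δ, h'.1, h'.2, h⟩
  set q := (1 - δ) ^ (-γ) with hq
  have hq0 : 0 < q := Real.rpow_pos_of_pos (by linarith) _
  set E := D * δ ^ (-γ) with hE
  have hE0 : 0 ≤ E := by positivity
  -- `M` satisfies `(1 - β) q M + E / β ≤ M`, which closes the induction; the `1` covers `n = 0`.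
  set M := max 1 (E * (1 / β) / (1 - (1 - β) * q)) with hM
  have hM0 : 0 ≤ M := zero_le_one.trans (le_max_left _ _)
  have hMq : (1 - β) * q * M + E * (1 / β) ≤ M := by
    have := le_max_right 1 (E * (1 / β) / (1 - (1 - β) * q))
    rw [div_le_iff₀ (by linarith)] at this
    rw [← hM] at this
    linarith
  refine ⟨M, fun n => ?_⟩
  induction n using Nat.strong_induction_on with
  | _ n ih =>
    rcases n with _ | n
    · simp [houseOfCardsLaw, hM]
    · rw [houseOfCardsLaw_renewal, Finset.sum_mul]
      have hterm : ∀ k ∈ Finset.range (n + 1),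
          fallProb a k * houseOfCardsLaw a (n - k) 0 * (((n + 1 : ℕ) : ℝ) + 1) ^ γ ≤
            q * M * fallProb a k + E * houseOfCardsLaw a (n - k) 0 := by
        intro k hk
        have hkn : k ≤ n := by simpa [Nat.lt_succ_iff] using hk
        have hw : (0 : ℝ) < ((n + 1 : ℕ) : ℝ) + 1 := by positivity
        -- Short first return: the remaining time is comparable to `n`, and the induction hypothesis
        -- applies. Long first return: the factor `fallProb a k` itself carries the polynomial
        -- decay.
        rcases le_or_gt ((k : ℝ) + 1) (δ * (((n + 1 : ℕ) : ℝ) + 1)) with hle | hgt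
        · have hcast : (((n - k : ℕ) : ℝ) + 1) = (((n + 1 : ℕ) : ℝ) + 1) - (k + 1) := by
            push_cast [Nat.cast_sub hkn]; ring
          have hge : (1 - δ) * (((n + 1 : ℕ) : ℝ) + 1) ≤ ((n - k : ℕ) : ℝ) + 1 := by
            rw [hcast]; linarith
          have hpow : (((n + 1 : ℕ) : ℝ) + 1) ^ γ ≤ q * (((n - k : ℕ) : ℝ) + 1) ^ γ := by
            have := Real.rpow_le_rpow (mul_nonneg (by linarith) hw.le) hge hγ.le
            rw [Real.mul_rpow (by linarith) hw.le] at this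
            rw [hq, Real.rpow_neg (by linarith), inv_mul_eq_div, le_div_iff₀
              (Real.rpow_pos_of_pos (by linarith) _), mul_comm]
            exact this
          have h2 : houseOfCardsLaw a (n - k) 0 * (((n + 1 : ℕ) : ℝ) + 1) ^ γ ≤ q * M :=
            calc _ ≤ houseOfCardsLaw a (n - k) 0 * (q * (((n - k : ℕ) : ℝ) + 1) ^ γ) :=
                  mul_le_mul_of_nonneg_left hpow (hr0 _)
              _ = q * (houseOfCardsLaw a (n - k) 0 * (((n - k : ℕ) : ℝ) + 1) ^ γ) := by ring
              _ ≤ q * M := mul_le_mul_of_nonneg_left (ih _ (by omega)) hq0.le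
          have := mul_le_mul_of_nonneg_left h2 (hf0 k)
          have := mul_nonneg hE0 (hr0 (n - k))
          linarith
        · have hpow : (((n + 1 : ℕ) : ℝ) + 1) ^ γ ≤ δ ^ (-γ) * ((k : ℝ) + 1) ^ γ := by
            have := Real.rpow_le_rpow (mul_nonneg hδ0.le hw.le) hgt.le hγ.le
            rw [Real.mul_rpow hδ0.le hw.le] at this
            rw [Real.rpow_neg hδ0.le, inv_mul_eq_div, le_div_iff₀
              (Real.rpow_pos_of_pos hδ0 _), mul_comm]
            exact this
          have h2 : fallProb a k * (((n + 1 : ℕ) : ℝ) + 1) ^ γ ≤ E :=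
            calc _ ≤ fallProb a k * (δ ^ (-γ) * ((k : ℝ) + 1) ^ γ) :=
                  mul_le_mul_of_nonneg_left hpow (hf0 _)
              _ = (fallProb a k * ((k : ℝ) + 1) ^ γ) * δ ^ (-γ) := by ring
              _ ≤ E := mul_le_mul_of_nonneg_right (hD k) (by positivity)
          have := mul_le_mul_of_nonneg_right h2 (hr0 (n - k))
          have := mul_nonneg (mul_nonneg hq0.le hM0) (hf0 k)
          linarith
      refine (Finset.sum_le_sum hterm).trans ?_
      rw [Finset.sum_add_distrib, ← Finset.mul_sum, ← Finset.mul_sum, sum_fallProb]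
      have h3 : ∑ k ∈ Finset.range (n + 1), houseOfCardsLaw a (n - k) 0 ≤ 1 / β := by
        have := sum_returnProb_le h0 h1 hβ hβk (n + 1)
        rw [← Finset.sum_range_reflect] at this
        simpa using this
      calc _ ≤ q * M * (1 - β) + E * (1 / β) := by
            gcongr
            exact hβk _
        _ ≤ M := by linarith

include h1 in
/-- The return probabilities decay at the same polynomial rate as `1 - a k`. -/
lemma returnProb_isTheta (hpos : ∀ k, 0 < a k) {γ : ℝ} (hγ : 1 < γ)
    (h : (fun k : ℕ => 1 - a k) =Θ[atTop] fun k : ℕ => (k : ℝ) ^ (-γ)) :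
    (fun k : ℕ => houseOfCardsLaw a k 0) =Θ[atTop] fun k : ℕ => (k : ℝ) ^ (-γ) := by
  have h0 := fun k => (hpos k).le
  have hs : Summable fun k => 1 - a k :=
    summable_of_isBigO_nat (Real.summable_nat_rpow.2 (by linarith)) h.1
  obtain ⟨β, hβ, hβk⟩ := exists_le_climbProb hpos h1 hs
  have hr0 := fun n => houseOfCardsLaw_nonneg h0 h1 n 0
  constructor
  · have hO := h.trans (isTheta_rpow_add_one γ).symm
    obtain ⟨D, hD⟩ := (isBigO_nat_atTop_iff fun k hk => absurd hk (by positivity)).1 hO.1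
    obtain ⟨M, hM⟩ := returnProb_le_polynomial h1 h0 hβ hβk (γ := γ) (by linarith) (D := D)
      fun k => by
        have := hD k
        rw [Real.norm_of_nonneg (sub_nonneg.2 (h1 k)), Real.norm_of_nonneg (by positivity),
          Real.rpow_neg (by positivity), ← div_eq_mul_inv, le_div_iff₀ (by positivity)] at this
        exact (mul_le_mul_of_nonneg_right (fallProb_le h0 h1 k) (by positivity)).trans this
    refine IsBigO.trans (IsBigO.of_bound M (Eventually.of_forall fun n => ?_))
      (isTheta_rpow_add_one γ).1
    rw [Real.norm_of_nonneg (hr0 n), Real.norm_of_nonneg (by positivity),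
      Real.rpow_neg (by positivity), ← div_eq_mul_inv, le_div_iff₀ (by positivity)]
    exact hM n
  -- Lower bound from a single scenario, a first return exactly at time `k + 1`, whose probability
  -- is at least `β (1 - a k)`.
  · have hlow : (fun k : ℕ => 1 - a k) =O[atTop] fun k : ℕ => houseOfCardsLaw a (k + 1) 0 := by
      refine IsBigO.of_bound (1 / β) (Eventually.of_forall fun k => ?_)
      rw [Real.norm_of_nonneg (sub_nonneg.2 (h1 k)), Real.norm_of_nonneg (hr0 _),
        one_div, inv_mul_eq_div, le_div_iff₀ hβ, houseOfCardsLaw_renewal, mul_comm]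
      refine le_trans ?_ (Finset.single_le_sum
        (f := fun j => fallProb a j * houseOfCardsLaw a (k - j) 0) (fun j _ =>
        mul_nonneg (fallProb_nonneg h0 h1 j) (hr0 _)) (Finset.self_mem_range_succ k))
      simp only [Nat.sub_self, houseOfCardsLaw_zero_zero, mul_one]
      exact mul_le_mul_of_nonneg_right (hβk k) (sub_nonneg.2 (h1 k))
    have hshift := ((isTheta_rpow_add_one γ).1.trans h.2).trans hlow
    rw [← map_add_atTop_eq_nat 1, isBigO_map]
    simpa [Function.comp_def] using hshift

end Renewal

/-! ### Minorants of the kernel -/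

namespace TransitionKernel

variable {G : Type*} (P : TransitionKernel G)

lemma concatHistory_congr {k : ℕ} {w w' : ℕ → G} (h : ∀ i < k, w i = w' i) (z : ℕ → G) :
    concatHistory k w z = concatHistory k w' z := by
  funext i
  unfold concatHistory
  split_ifs with hi
  exacts [h i hi, rfl]

lemma concatHistory_self (k : ℕ) (w : ℕ → G) : concatHistory k w (fun i => w (k + i)) = w := by
  funext i
  unfold concatHistory
  split_ifs with hi
  · rfl
  · simp only [Nat.add_sub_cancel' (not_lt.1 hi)]

lemma concatHistory_succ (k : ℕ) (w z : ℕ → G) :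
    concatHistory (k + 1) w z =
      concatHistory k w (fun i => if i = 0 then w k else z (i - 1)) := by
  funext i
  unfold concatHistory
  by_cases hi : i < k
  · simp [hi, Nat.lt_succ_of_lt hi]
  · rcases eq_or_ne i k with rfl | hne
    · simp
    · simp [hi, show ¬ i < k + 1 by omega, show i - k ≠ 0 by omega,
        show i - (k + 1) = i - k - 1 by omega]

lemma bddBelow_prob (k : ℕ) (g : G) (w : ℕ → G) :
    BddBelow (Set.range fun z => P.prob g (concatHistory k w z)) :=
  ⟨0, by rintro _ ⟨z, rfl⟩; exact P.prob_nonneg _ _⟩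

lemma aCond_nonneg (k : ℕ) (g : G) (w : ℕ → G) : 0 ≤ P.aCond k g w :=
  Real.iInf_nonneg fun _ => P.prob_nonneg _ _

lemma aCond_le_prob (k : ℕ) (g : G) (w : ℕ → G) : P.aCond k g w ≤ P.prob g w := by
  conv_rhs => rw [← concatHistory_self k w]
  exact ciInf_le (P.bddBelow_prob k g w) _

lemma aCond_le_succ (k : ℕ) (g : G) (w : ℕ → G) : P.aCond k g w ≤ P.aCond (k + 1) g w := by
  have : Nonempty (ℕ → G) := ⟨w⟩
  refine le_ciInf fun z => ?_
  rw [concatHistory_succ]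
  exact ciInf_le (P.bddBelow_prob k g w) _

lemma aCond_congr {k : ℕ} {w w' : ℕ → G} (h : ∀ i < k, w i = w' i) (g : G) :
    P.aCond k g w = P.aCond k g w' := by
  simp_rw [aCond, concatHistory_congr h]

lemma summable_aCond (k : ℕ) (w : ℕ → G) : Summable fun g => P.aCond k g w :=
  Summable.of_nonneg_of_le (fun _ => P.aCond_nonneg _ _ _) (fun _ => P.aCond_le_prob _ _ _)
    (P.hasSum_prob w).summable

lemma tsum_aCond_le_one (k : ℕ) (w : ℕ → G) : ∑' g, P.aCond k g w ≤ 1 := by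
  rw [← (P.hasSum_prob w).tsum_eq]
  exact (P.summable_aCond k w).tsum_le_tsum (fun _ => P.aCond_le_prob _ _ _)
    (P.hasSum_prob w).summable

lemma bddBelow_tsum_aCond (k : ℕ) : BddBelow (Set.range fun w => ∑' g, P.aCond k g w) :=
  ⟨0, by rintro _ ⟨w, rfl⟩; exact tsum_nonneg fun _ => P.aCond_nonneg _ _ _⟩

lemma a_nonneg (k : ℕ) : 0 ≤ P.a k :=
  Real.iInf_nonneg fun _ => tsum_nonneg fun _ => P.aCond_nonneg _ _ _

lemma a_le_tsum (k : ℕ) (w : ℕ → G) : P.a k ≤ ∑' g, P.aCond k g w :=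
  ciInf_le (P.bddBelow_tsum_aCond k) w

lemma a_le_one [Nonempty G] (k : ℕ) : P.a k ≤ 1 :=
  (P.a_le_tsum k fun _ => Classical.arbitrary G).trans (P.tsum_aCond_le_one _ _)

lemma a_mono [Nonempty G] : Monotone P.a := monotone_nat_of_le_succ fun k =>
  le_ciInf fun w => (P.a_le_tsum k w).trans
    ((P.summable_aCond k w).tsum_le_tsum (fun _ => P.aCond_le_succ _ _ _) (P.summable_aCond _ w))

lemma betaProd_eq (m : ℕ) : P.betaProd m = climbProb P.a (m + 1) := rfl

lemma aCondPred_nonneg (k : ℕ) (g : G) (w : ℕ → G) : 0 ≤ P.aCondPred k g w := by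
  cases k
  exacts [le_rfl, P.aCond_nonneg _ _ _]

lemma aCondPred_le (k : ℕ) (g : G) (w : ℕ → G) : P.aCondPred k g w ≤ P.aCond k g w := by
  cases k
  exacts [P.aCond_nonneg _ _ _, P.aCond_le_succ _ _ _]

lemma aCondPred_congr {k : ℕ} {w w' : ℕ → G} (h : ∀ i < k, w i = w' i) (g : G) :
    P.aCondPred k g w = P.aCondPred k g w' := by
  cases k
  exacts [rfl, P.aCond_congr (fun i hi => h i (Nat.lt_succ_of_lt hi)) g]

lemma summable_aCondPred (k : ℕ) (w : ℕ → G) : Summable fun g => P.aCondPred k g w :=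
  Summable.of_nonneg_of_le (fun _ => P.aCondPred_nonneg _ _ _) (fun _ => P.aCondPred_le _ _ _)
    (P.summable_aCond k w)

lemma b_nonneg (k : ℕ) (g : G) (w : ℕ → G) : 0 ≤ P.b k g w := sub_nonneg.2 (P.aCondPred_le _ _ _)

lemma summable_b (k : ℕ) (w : ℕ → G) : Summable fun g => P.b k g w :=
  (P.summable_aCond k w).sub (P.summable_aCondPred k w)

lemma b_congr {k : ℕ} {w w' : ℕ → G} (h : ∀ i < k, w i = w' i) (g : G) :
    P.b k g w = P.b k g w' := by
  rw [b, b, P.aCond_congr h, P.aCondPred_congr h]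

lemma tsum_b (k : ℕ) (w : ℕ → G) :
    ∑' g, P.b k g w = ∑' g, P.aCond k g w - ∑' g, P.aCondPred k g w :=
  (P.summable_aCond k w).tsum_sub (P.summable_aCondPred k w)

lemma sum_b (n : ℕ) (g : G) (w : ℕ → G) :
    ∑ k ∈ Finset.range (n + 1), P.b k g w = P.aCond n g w := by
  induction n with
  | zero => simp [b, aCondPred]
  | succ n ih => rw [Finset.sum_range_succ, ih]; simp [b, aCondPred]

/-- Otherwise `a k ≤ c < 1` for all `k`, and `β_m ≤ c ^ m` would be summable. -/
lemma a_tendsto_one [Nonempty G]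
    (hβ : Tendsto (fun n => ∑ m ∈ Finset.range n, P.betaProd m) atTop atTop) :
    Tendsto P.a atTop (𝓝 1) := by
  refine tendsto_atTop_isLUB P.a_mono ⟨by rintro _ ⟨k, rfl⟩; exact P.a_le_one k, fun c hc => ?_⟩
  have hc' : ∀ k, P.a k ≤ c := fun k => hc ⟨k, rfl⟩
  by_contra! hlt
  have hc0 : 0 ≤ c := (P.a_nonneg 0).trans (hc' 0)
  have hle : ∀ n, ∑ m ∈ Finset.range n, P.betaProd m ≤ (1 - c)⁻¹ := fun n => by
    refine le_trans (Finset.sum_le_sum (g := fun m => c ^ m) fun m _ => ?_)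
      (((summable_geometric_of_lt_one hc0 hlt).sum_le_tsum _ fun _ _ => by positivity).trans_eq
        (tsum_geometric_of_lt_one hc0 hlt))
    rw [betaProd, Finset.prod_range_succ]
    refine (mul_le_of_le_one_right (Finset.prod_nonneg fun _ _ => P.a_nonneg _)
      (P.a_le_one m)).trans ?_
    exact (Finset.prod_le_prod (fun _ _ => P.a_nonneg _) fun k _ => hc' k).trans_eq (by simp)
  obtain ⟨n, hn⟩ := (hβ.eventually_gt_atTop (1 - c)⁻¹).exists
  exact absurd (hle n) (not_le.2 hn)

/-- A single vanishing factor would kill all later `β_m` and make the series finite. -/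
lemma a_pos (hβ : Tendsto (fun n => ∑ m ∈ Finset.range n, P.betaProd m) atTop atTop) (k : ℕ) :
    0 < P.a k := by
  refine lt_of_le_of_ne (P.a_nonneg k) fun h => ?_
  have hz : ∀ m, k ≤ m → P.betaProd m = 0 := fun m hm =>
    Finset.prod_eq_zero (Finset.mem_range.2 (Nat.lt_succ_of_le hm)) h.symm
  have hc : ∀ n, k ≤ n →
      ∑ m ∈ Finset.range n, P.betaProd m = ∑ m ∈ Finset.range k, P.betaProd m := fun n hn =>
    (Finset.sum_subset (Finset.range_mono hn) fun m _ hm => hz m (by simpa using hm)).symm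
  obtain ⟨n, hn, hn'⟩ := ((hβ.eventually_gt_atTop (∑ m ∈ Finset.range k, P.betaProd m)).and
    (eventually_ge_atTop k)).exists
  exact hn.ne' (hc n hn')

/-- The defects `P(g | w) - a_k(g | w)` are nonnegative and sum over `g` to at most `1 - a k`, so
each one is at most `1 - a k`. -/
lemma tendsto_aCond (ha : Tendsto P.a atTop (𝓝 1)) (g : G) (w : ℕ → G) :
    Tendsto (fun k => P.aCond k g w) atTop (𝓝 (P.prob g w)) := by
  have hle : ∀ k, P.prob g w - (1 - P.a k) ≤ P.aCond k g w := fun k => by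
    have h := (((P.hasSum_prob w).summable.sub (P.summable_aCond k w)).le_tsum g
      fun j _ => sub_nonneg.2 (P.aCond_le_prob k j w))
    rw [(P.hasSum_prob w).summable.tsum_sub (P.summable_aCond k w), (P.hasSum_prob w).tsum_eq] at h
    linarith [P.a_le_tsum k w]
  refine tendsto_of_tendsto_of_tendsto_of_le_of_le ?_ tendsto_const_nhds hle
    fun k => P.aCond_le_prob k g w
  simpa using (tendsto_const_nhds (x := P.prob g w)).sub
    ((tendsto_const_nhds (x := (1 : ℝ))).sub ha)

lemma hasSum_b (ha : Tendsto P.a atTop (𝓝 1)) (g : G) (w : ℕ → G) :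
    HasSum (fun k => P.b k g w) (P.prob g w) := by
  rw [hasSum_iff_tendsto_nat_of_nonneg fun k => P.b_nonneg k g w,
    ← tendsto_add_atTop_iff_nat 1]
  simpa only [sum_b] using P.tendsto_aCond ha g w

/-! ### The stacked intervals and the letters drawn from them -/

section Intervals

variable (e : G ↪ ℕ)

lemma summable_ite_b (k : ℕ) (w : ℕ → G) (p : G → Prop) [DecidablePred p] :
    Summable fun g => if p g then P.b k g w else 0 :=
  Summable.of_nonneg_of_le (fun g => by split_ifs; exacts [P.b_nonneg _ _ _, le_rfl])
    (fun g => by split_ifs; exacts [le_rfl, P.b_nonneg _ _ _]) (P.summable_b k w)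

lemma leftEnd_congr {k : ℕ} {w w' : ℕ → G} (h : ∀ i < k, w i = w' i) (g : G) :
    P.leftEnd e k g w = P.leftEnd e k g w' := by
  simp_rw [leftEnd, P.aCondPred_congr h, P.b_congr h]

lemma B_congr {k : ℕ} {w w' : ℕ → G} (h : ∀ i < k, w i = w' i) (g : G) :
    P.B e k g w = P.B e k g w' := by
  rw [B, B, P.leftEnd_congr e h, P.b_congr h]

lemma BTrunc_congr {l k : ℕ} {w w' : ℕ → G} (h : ∀ i < l, w i = w' i) (g : G) :
    P.BTrunc e l k g w = P.BTrunc e l k g w' := by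
  rw [BTrunc, BTrunc, P.B_congr e h]

lemma tsum_aCondPred_le_leftEnd (k : ℕ) (g : G) (w : ℕ → G) :
    ∑' g', P.aCondPred k g' w ≤ P.leftEnd e k g w :=
  le_add_of_nonneg_right (tsum_nonneg fun g => by split_ifs; exacts [P.b_nonneg _ _ _, le_rfl])

/-- Puts the right end in the form of a left end with threshold `e g + 1`, so that consecutive
intervals are compared through one partial sum. -/
lemma leftEnd_add_b (k : ℕ) (g : G) (w : ℕ → G) :
    P.leftEnd e k g w + P.b k g w =
      ∑' g', P.aCondPred k g' w + ∑' g', if e g' < e g + 1 then P.b k g' w else 0 := by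
  classical
  rw [leftEnd, add_assoc]
  congr 1
  have h : ∑' g', (if g' = g then P.b k g' w else 0) = P.b k g w := by
    rw [tsum_eq_single g fun g' h => by simp [h]]; simp
  rw [← h, ← (P.summable_ite_b k w _).tsum_add (P.summable_ite_b k w _)]
  refine tsum_congr fun g' => ?_
  rcases lt_trichotomy (e g') (e g) with hlt | heq | hgt
  · simp [hlt, Nat.lt_succ_of_lt hlt, show g' ≠ g by rintro rfl; exact lt_irrefl _ hlt]
  · simp [e.injective heq]
  · simp [not_lt.2 hgt.le, show ¬ e g' < e g + 1 by omega,
      show g' ≠ g by rintro rfl; exact lt_irrefl _ hgt]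

lemma leftEnd_add_b_le (k : ℕ) (g : G) (w : ℕ → G) :
    P.leftEnd e k g w + P.b k g w ≤ ∑' g', P.aCond k g' w := by
  have := (P.summable_ite_b k w fun g' => e g' < e g + 1).tsum_le_tsum
    (fun g' => by split_ifs; exacts [le_rfl, P.b_nonneg _ _ _]) (P.summable_b k w)
  rw [leftEnd_add_b]
  rw [tsum_b] at this
  linarith

lemma leftEnd_add_b_le_leftEnd {k : ℕ} {g g' : G} (h : e g < e g') (w : ℕ → G) :
    P.leftEnd e k g w + P.b k g w ≤ P.leftEnd e k g' w := by
  rw [leftEnd_add_b, leftEnd]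
  refine add_le_add_right ((P.summable_ite_b k w _).tsum_le_tsum (fun j => ?_)
    (P.summable_ite_b k w _)) _
  by_cases hj : e j < e g + 1
  · simp [hj, show e j < e g' by omega]
  · simp only [hj, if_false]
    split_ifs
    exacts [P.b_nonneg _ _ _, le_rfl]

lemma tsum_aCond_le_tsum_aCondPred {k l : ℕ} (h : k < l) (w : ℕ → G) :
    ∑' g, P.aCond k g w ≤ ∑' g, P.aCondPred l g w := by
  obtain ⟨l, rfl⟩ : ∃ l', l = l' + 1 := ⟨l - 1, by omega⟩
  refine (P.summable_aCond k w).tsum_le_tsum (fun g => ?_) (P.summable_aCond l w)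
  exact monotone_nat_of_le_succ (fun j => P.aCond_le_succ j g w) (Nat.lt_succ_iff.1 h)

lemma B_index_unique {k l : ℕ} {g g' : G} {w : ℕ → G} {x : ℝ}
    (h : x ∈ P.B e k g w) (h' : x ∈ P.B e l g' w) : k = l ∧ g = g' := by
  have aux : ∀ {k l : ℕ} {g g' : G}, x ∈ P.B e k g w → x ∈ P.B e l g' w → ¬ k < l :=
    fun {k l g g'} h h' hlt => by
      have := P.leftEnd_add_b_le e k g w
      have := P.tsum_aCond_le_tsum_aCondPred hlt w
      have := P.tsum_aCondPred_le_leftEnd e l g' w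
      linarith [h.2, h'.1]
  obtain rfl : k = l := le_antisymm (not_lt.1 (aux h' h)) (not_lt.1 (aux h h'))
  refine ⟨rfl, e.injective ?_⟩
  rcases lt_trichotomy (e g) (e g') with hlt | heq | hgt
  · linarith [h.2, h'.1, P.leftEnd_add_b_le_leftEnd e (k := k) hlt w]
  · exact heq
  · linarith [h'.2, h.1, P.leftEnd_add_b_le_leftEnd e (k := k) hgt w]

lemma exists_mem_B_of_mem_Ico {k : ℕ} {w : ℕ → G} {x : ℝ}
    (h : ∑' g, P.aCondPred k g w ≤ x) (h' : x < ∑' g, P.aCond k g w) :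
    ∃ g, x ∈ P.B e k g w := by
  classical
  -- `S n` is where the letters of code below `n` stop within layer `k`. The first `n` with `x < S
  -- n` is positive since `S 0 ≤ x`, and its predecessor must be the code of a letter, as `S` does
  -- not jump at unused codes.
  set S : ℕ → ℝ := fun n =>
    ∑' g', P.aCondPred k g' w + ∑' g', if e g' < n then P.b k g' w else 0 with hS
  have hlim : Tendsto S atTop (𝓝 (∑' g, P.aCond k g w)) := by
    have : ∑' g, P.aCond k g w = ∑' g, P.aCondPred k g w + ∑' g, P.b k g w := by
      rw [tsum_b]; ring
    rw [this]
    refine tendsto_const_nhds.add (tendsto_tsum_of_dominated_convergence (P.summable_b k w)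
      (fun g => ?_) (Eventually.of_forall fun n g => ?_))
    · refine tendsto_const_nhds.congr' ?_
      filter_upwards [eventually_gt_atTop (e g)] with n hn
      simp [hn]
    · split_ifs
      · rw [Real.norm_of_nonneg (P.b_nonneg _ _ _)]
      · rw [norm_zero]; exact P.b_nonneg _ _ _
  have hex : ∃ n, x < S n := (hlim.eventually (lt_mem_nhds h')).exists
  obtain ⟨n, hn⟩ : ∃ n, Nat.find hex = n + 1 := by
    refine Nat.exists_eq_succ_of_ne_zero fun h0 => ?_
    have := Nat.find_spec hex
    rw [h0] at this
    simp [hS] at this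
    linarith
  have hlt : x < S (n + 1) := hn ▸ Nat.find_spec hex
  have hle : S n ≤ x := not_lt.1 (Nat.find_min hex (by omega))
  by_cases hg : ∃ g, e g = n
  · obtain ⟨g, rfl⟩ := hg
    exact ⟨g, hle, by rw [leftEnd_add_b]; exact hlt⟩
  · push Not at hg
    have : S (n + 1) = S n := by
      simp only [hS]
      congr 1
      refine tsum_congr fun g => ?_
      have := hg g
      simp [show e g < n + 1 ↔ e g < n by omega]
    linarith

lemma exists_mem_B {k : ℕ} {w : ℕ → G} {x : ℝ} (h : 0 ≤ x) (h' : x < ∑' g, P.aCond k g w) :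
    ∃ g, ∃ l ≤ k, x ∈ P.B e l g w := by
  induction k with
  | zero =>
    obtain ⟨g, hg⟩ := P.exists_mem_B_of_mem_Ico e (k := 0) (by simpa [aCondPred] using h) h'
    exact ⟨g, 0, le_rfl, hg⟩
  | succ k ih =>
    rcases lt_or_ge x (∑' g, P.aCond k g w) with hlt | hge
    · obtain ⟨g, l, hl, hg⟩ := ih hlt
      exact ⟨g, l, Nat.le_succ_of_le hl, hg⟩
    · obtain ⟨g, hg⟩ := P.exists_mem_B_of_mem_Ico e (k := k + 1) hge h'
      exact ⟨g, k + 1, le_rfl, hg⟩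

lemma B_subset_Ico (k : ℕ) (g : G) (w : ℕ → G) : P.B e k g w ⊆ Set.Ico 0 1 := fun _ hx =>
  ⟨((tsum_nonneg fun _ => P.aCondPred_nonneg _ _ _).trans
    (P.tsum_aCondPred_le_leftEnd e k g w)).trans hx.1,
    hx.2.trans_le ((P.leftEnd_add_b_le e k g w).trans (P.tsum_aCond_le_one k w))⟩

lemma letter_eq_of_mem {g₀ g : G} {l k : ℕ} {x : ℝ} {w : ℕ → G} (hl : l ≤ k)
    (h : x ∈ P.BTrunc e l k g w) : P.letter e g₀ k x w = g := by
  have hex : ∃ g, ∃ l ≤ k, x ∈ P.BTrunc e l k g w := ⟨g, l, hl, h⟩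
  rw [letter, dif_pos hex]
  obtain ⟨l', -, h'⟩ := hex.choose_spec
  exact (P.B_index_unique e h'.2 h.2).2

lemma exists_mem_BTrunc {k : ℕ} {x : ℝ} (hx : 0 ≤ x) (hxa : x < P.a k) (w : ℕ → G) :
    ∃ g, ∃ l ≤ k, x ∈ P.BTrunc e l k g w := by
  obtain ⟨g, l, hl, h⟩ := P.exists_mem_B e hx (hxa.trans_le (P.a_le_tsum k w))
  exact ⟨g, l, hl, ⟨hx, hxa⟩, h⟩

/-- The letter drawn from `x` only depends on the symbols that `x` requires to be known. -/
lemma letter_congr {g₀ : G} {k k' : ℕ} (hk : P.a k ≤ P.a k') (hkk' : k ≤ k') {x : ℝ} (hx : 0 ≤ x)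
    (hxa : x < P.a k) {w w' : ℕ → G} (h : ∀ i < k, w i = w' i) :
    P.letter e g₀ k x w = P.letter e g₀ k' x w' := by
  obtain ⟨g, l, hl, hg⟩ := P.exists_mem_BTrunc e hx hxa w
  rw [P.letter_eq_of_mem e hl hg, P.letter_eq_of_mem e (hl.trans hkk')]
  rw [← P.BTrunc_congr e (fun i hi => h i (hi.trans_le hl))]
  exact ⟨⟨hg.1.1, hg.1.2.trans_le hk⟩, hg.2⟩

/-- By disjointness of the intervals, both the truncation at `a k` and the restriction `l ≤ k` can
be dropped. The criterion no longer mentions `k`, which will be a random age. -/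
lemma letter_eq_iff {g₀ g : G} {k : ℕ} {x : ℝ} (hx : 0 ≤ x) (hxa : x < P.a k) {w w' : ℕ → G}
    (h : ∀ i < k, w i = w' i) :
    P.letter e g₀ k x w = g ↔ x ∈ ⋃ l, P.B e l g w' := by
  obtain ⟨g', l, hl, hg⟩ := P.exists_mem_BTrunc e hx hxa w
  rw [P.letter_eq_of_mem e hl hg]
  have hB : x ∈ P.B e l g' w' := P.B_congr e (fun i hi => h i (hi.trans_le hl)) g' ▸ hg.2
  refine ⟨fun hgg => Set.mem_iUnion.2 ⟨l, hgg ▸ hB⟩, fun hx => ?_⟩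
  obtain ⟨l', hl'⟩ := Set.mem_iUnion.1 hx
  exact (P.B_index_unique e hB hl').2

/-- The letter ignores the symbols beyond the first `k`. -/
lemma letter_congr_history {g₀ : G} {k : ℕ} {x : ℝ} {w w' : ℕ → G} (h : ∀ i < k, w i = w' i) :
    P.letter e g₀ k x w = P.letter e g₀ k x w' := by
  have : (∃ g, ∃ l ≤ k, x ∈ P.BTrunc e l k g w) ↔ ∃ g, ∃ l ≤ k, x ∈ P.BTrunc e l k g w' :=
    exists_congr fun g => exists_congr fun l => and_congr_right fun hl => by
      rw [P.BTrunc_congr e (fun i hi => h i (hi.trans_le hl))]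
  by_cases hex : ∃ g, ∃ l ≤ k, x ∈ P.BTrunc e l k g w
  · obtain ⟨g, l, hl, hg⟩ := hex
    rw [P.letter_eq_of_mem e hl hg, P.letter_eq_of_mem e hl
      (P.BTrunc_congr e (fun i hi => h i (hi.trans_le hl)) g ▸ hg)]
  · rw [letter, letter, dif_neg hex, dif_neg (this.not.1 hex)]

end Intervals

/-! ### Regeneration times -/

section RegenerationTime

variable {P} {u v : ℤ → Set.Ico (0 : ℝ) 1} {s : ℤ} {t : WithTop ℤ} {m : ℤ}

lemma mem_upperBounds_regenSet : s ∈ upperBounds (P.regenSet u s t) := fun _ h => h.1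

lemma tau_eq_coe_iff : P.tau u s t = (m : WithBot ℤ) ↔ IsGreatest (P.regenSet u s t) m := by
  unfold tau
  split_ifs with h
  · have hm := Int.csSup_mem h ⟨s, mem_upperBounds_regenSet⟩
    have hg : IsGreatest (P.regenSet u s t) (sSup (P.regenSet u s t)) :=
      ⟨hm, fun _ hx => le_csSup ⟨s, mem_upperBounds_regenSet⟩ hx⟩
    rw [WithBot.coe_inj]
    exact ⟨fun h => h ▸ hg, fun h => hg.unique h⟩
  · exact ⟨fun h => absurd h WithBot.bot_ne_coe, fun hg => absurd ⟨m, hg.1⟩ h⟩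

lemma tau_eq_bot_iff : P.tau u s t = ⊥ ↔ P.regenSet u s t = ∅ := by
  unfold tau
  split_ifs with h
  · simp [h.ne_empty]
  · simpa using Set.not_nonempty_iff_eq_empty.1 h

lemma exists_isGreatest_of_mem (h : m ∈ P.regenSet u s t) :
    ∃ m', IsGreatest (P.regenSet u s t) m' := by
  rcases hτ : P.tau u s t with _ | m'
  · rw [tau_eq_bot_iff.1 hτ] at h
    exact h.elim
  · exact ⟨m', tau_eq_coe_iff.1 hτ⟩

lemma tau_lt_coe_iff {c : ℤ} : P.tau u s t < (c : WithBot ℤ) ↔ ∀ m ∈ P.regenSet u s t, m < c := by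
  constructor
  · intro h m hm
    obtain ⟨m', hm'⟩ := exists_isGreatest_of_mem hm
    rw [tau_eq_coe_iff.2 hm', WithBot.coe_lt_coe] at h
    exact (hm'.2 hm).trans_lt h
  · intro h
    rcases hτ : P.tau u s t with _ | m'
    · exact WithBot.bot_lt_coe c
    · exact WithBot.coe_lt_coe.2 (h m' (tau_eq_coe_iff.1 hτ).1)

lemma mem_regenSet_self : m ∈ P.regenSet u s (s : WithTop ℤ) ↔
    m ≤ s ∧ ∀ k, m ≤ k → k ≤ s → (u k : ℝ) < P.a (k - m).toNat := by
  simp [regenSet]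

lemma mem_regenSet_self_of_mem {i : ℤ} (h : m ∈ P.regenSet u s t) (hs : s ≤ i)
    (ht : (i : WithTop ℤ) ≤ t) : m ∈ P.regenSet u i (i : WithTop ℤ) :=
  mem_regenSet_self.2 ⟨h.1.trans hs, fun k hk hki =>
    h.2 k hk (le_trans (WithTop.coe_le_coe.2 hki) ht)⟩

lemma mem_regenSet_self_of_le {j : ℤ} (h : m ∈ P.regenSet u s (s : WithTop ℤ)) (hm : m ≤ j)
    (hj : j ≤ s) : m ∈ P.regenSet u j (j : WithTop ℤ) :=
  mem_regenSet_self.2 ⟨hm, fun k hk hkj => (mem_regenSet_self.1 h).2 k hk (hkj.trans hj)⟩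

lemma mem_regenSet_self_congr (h : ∀ k, m ≤ k → k ≤ s → v k = u k) :
    m ∈ P.regenSet u s (s : WithTop ℤ) ↔ m ∈ P.regenSet v s (s : WithTop ℤ) := by
  rw [mem_regenSet_self, mem_regenSet_self]
  refine and_congr_right fun _ => forall_congr' fun k => forall_congr' fun hk =>
    forall_congr' fun hks => ?_
  rw [h k hk hks]

end RegenerationTime

/-! ### Locality, consistency and shift equivariance of the recursion -/

variable (e : G ↪ ℕ) (g₀ : G)

/-- The symbol at time `m + k` produced by the recursion started at time `m`. -/
def runLetter (u : ℤ → Set.Ico (0 : ℝ) 1) (m : ℤ) (k : ℕ) : G :=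
  P.letter e g₀ k (u (m + k)) (P.runFrom e g₀ u m k)

variable {u v : ℤ → Set.Ico (0 : ℝ) 1}

lemma runFrom_apply (m : ℤ) {k i : ℕ} (hi : i < k) :
    P.runFrom e g₀ u m k i = P.runLetter e g₀ u m (k - 1 - i) := by
  induction k generalizing i with
  | zero => omega
  | succ k ih =>
    rcases i with _ | i
    · rfl
    · exact (ih (by omega)).trans (by rw [show k + 1 - 1 - (i + 1) = k - 1 - i by omega])

lemma runFrom_congr {m : ℤ} {k : ℕ} (h : ∀ j : ℕ, j < k → v (m + j) = u (m + j)) :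
    P.runFrom e g₀ u m k = P.runFrom e g₀ v m k := by
  induction k with
  | zero => rfl
  | succ k ih =>
    funext i
    have hk := ih fun j hj => h j (Nat.lt_succ_of_lt hj)
    rcases i with _ | i
    · change P.letter e g₀ k (u (m + k)) _ = P.letter e g₀ k (v (m + k)) _
      rw [hk, h k (Nat.lt_succ_self k)]
    · exact congrFun hk i

lemma runLetter_congr {m : ℤ} {k : ℕ} (h : ∀ j : ℕ, j ≤ k → v (m + j) = u (m + j)) :
    P.runLetter e g₀ u m k = P.runLetter e g₀ v m k := by
  rw [runLetter, runLetter, P.runFrom_congr e g₀ fun j hj => h j hj.le, h k le_rfl]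

lemma Phi_eq_of_isGreatest {m n : ℤ} (h : IsGreatest (P.regenSet u n (n : WithTop ℤ)) m) :
    P.Phi e g₀ u n = P.runLetter e g₀ u m (n - m).toNat := by
  have hmn := h.1.1
  simp only [Phi, tau_eq_coe_iff.2 h, runLetter]
  rw [show m + ((n - m).toNat : ℤ) = n by omega]

lemma Phi_eq_of_eq_empty {n : ℤ} (h : P.regenSet u n (n : WithTop ℤ) = ∅) :
    P.Phi e g₀ u n = g₀ := by
  simp only [Phi, tau_eq_bot_iff.2 h]

/-- Knowing one regeneration time `m`, the last one is at least `m`, and membership of candidates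
from `m` on is decided by the values on `[m, i]` alone. -/
lemma Phi_congr_of_mem {m i : ℤ} (hm : m ∈ P.regenSet u i (i : WithTop ℤ))
    (h : ∀ k, m ≤ k → k ≤ i → v k = u k) : P.Phi e g₀ u i = P.Phi e g₀ v i := by
  obtain ⟨m', hm'⟩ := exists_isGreatest_of_mem hm
  have hmm' := hm'.2 hm
  have hv : IsGreatest (P.regenSet v i (i : WithTop ℤ)) m' := by
    refine ⟨(mem_regenSet_self_congr fun k hk => h k (hmm'.trans hk)).1 hm'.1, fun x hx => ?_⟩
    rcases le_total m x with hle | hle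
    · exact hm'.2 ((mem_regenSet_self_congr fun k hk => h k (hle.trans hk)).2 hx)
    · exact hle.trans hmm'
  rw [P.Phi_eq_of_isGreatest e g₀ hm', P.Phi_eq_of_isGreatest e g₀ hv]
  have := hm'.1.1
  exact P.runLetter_congr e g₀ fun j hj => h _ (by omega) (by omega)

lemma Phi_congr_of_forall_le {i : ℤ} (h : ∀ k ≤ i, v k = u k) :
    P.Phi e g₀ u i = P.Phi e g₀ v i := by
  rcases (P.regenSet u i (i : WithTop ℤ)).eq_empty_or_nonempty with he | ⟨m, hm⟩
  · rw [P.Phi_eq_of_eq_empty e g₀ he, P.Phi_eq_of_eq_empty e g₀]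
    refine Set.eq_empty_of_forall_notMem fun x hx => ?_
    rw [← mem_regenSet_self_congr fun k _ hk => h k hk, he] at hx
    exact hx
  · exact P.Phi_congr_of_mem e g₀ hm fun k _ hk => h k hk

/-- `Φ` on `[s, t]` only depends on the values between the regeneration time and `t`. -/
lemma Phi_congr {s i : ℤ} {t : WithTop ℤ}
    (h : ∀ k : ℤ, P.tau u s t ≤ (k : WithBot ℤ) → (k : WithTop ℤ) ≤ t → v k = u k)
    (hs : s ≤ i) (ht : (i : WithTop ℤ) ≤ t) : P.Phi e g₀ u i = P.Phi e g₀ v i := by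
  have ht' : ∀ k ≤ i, (k : WithTop ℤ) ≤ t := fun k hk => le_trans (WithTop.coe_le_coe.2 hk) ht
  rcases hτ : P.tau u s t with _ | m
  · exact P.Phi_congr_of_forall_le e g₀ fun k hk => h k (by rw [hτ]; exact bot_le) (ht' k hk)
  · exact P.Phi_congr_of_mem e g₀ (mem_regenSet_self_of_mem (tau_eq_coe_iff.1 hτ).1 hs ht)
      fun k hk hki => h k (by rw [hτ]; exact WithBot.coe_le_coe.2 hk) (ht' k hki)

/-- After a regeneration at time `m + d`, the recursions started at `m` and at `m + d` agree. -/
lemma runLetter_add (m : ℤ) (d K : ℕ) (h : ∀ k ≤ K, (u (m + d + k) : ℝ) < P.a k) :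
    P.runLetter e g₀ u (m + d) K = P.runLetter e g₀ u m (d + K) := by
  have : Nonempty G := ⟨g₀⟩
  induction K using Nat.strong_induction_on with
  | _ K ih =>
    have hu : u (m + ((d + K : ℕ) : ℤ)) = u (m + d + K) := by push_cast; rw [add_assoc]
    rw [runLetter, runLetter, hu]
    -- The bound `u < a K` means that both draws read only the last `K` symbols, which agree by
    -- induction.
    refine P.letter_congr e (P.a_mono (Nat.le_add_left K d)) (Nat.le_add_left K d)
      (u _).2.1 (h K le_rfl) fun i hi => ?_
    rw [P.runFrom_apply e g₀ _ hi, P.runFrom_apply e g₀ _ (by omega),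
      ih (K - 1 - i) (by omega) fun k hk => h k (by omega)]
    congr 1
    omega

/-- `runLetter_add` moves the start from the last regeneration time back to `m`. A fixed `m` can
then serve several target times at once. -/
lemma Phi_eq_of_mem {m n : ℤ} (h : m ∈ P.regenSet u n (n : WithTop ℤ)) :
    P.Phi e g₀ u n = P.runLetter e g₀ u m (n - m).toNat := by
  obtain ⟨m', hm'⟩ := exists_isGreatest_of_mem h
  have hmm' := hm'.2 h
  have hm'n := hm'.1.1
  rw [P.Phi_eq_of_isGreatest e g₀ hm']
  have hadd := P.runLetter_add e g₀ (u := u) m (m' - m).toNat (n - m').toNat fun k hk => by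
    have := (mem_regenSet_self.1 hm'.1).2 (m + (m' - m).toNat + k) (by omega) (by omega)
    rwa [show (m + ((m' - m).toNat : ℤ) + k - m').toNat = k by omega] at this
  rw [show m + ((m' - m).toNat : ℤ) = m' by omega] at hadd
  rw [hadd]
  congr 1
  omega

/-- A regeneration time for `n` is also one for every `j` in `[m, n]`, so the recursion from `m`
computes `Phi` at all these times. -/
lemma runFrom_eq_pastAt {m n : ℤ} (h : m ∈ P.regenSet u n (n : WithTop ℤ)) {i : ℕ}
    (hi : i < (n - m).toNat) :
    P.runFrom e g₀ u m (n - m).toNat i = pastAt n (P.Phi e g₀ u) i := by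
  rw [P.runFrom_apply e g₀ m hi, pastAt,
    P.Phi_eq_of_mem e g₀ (mem_regenSet_self_of_le h (by omega) (by omega))]
  congr 1
  omega

lemma Phi_eq_iff {n : ℤ} (h : P.tau u n (n : WithTop ℤ) ≠ ⊥) (g : G) :
    P.Phi e g₀ u n = g ↔ (u n : ℝ) ∈ ⋃ l, P.B e l g (pastAt n (P.Phi e g₀ u)) := by
  obtain ⟨m, hm⟩ := WithBot.ne_bot_iff_exists.1 h
  have hg := tau_eq_coe_iff.1 hm.symm
  have hmn := hg.1.1
  conv_lhs => rw [P.Phi_eq_of_isGreatest e g₀ hg, runLetter,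
    show m + ((n - m).toNat : ℤ) = n by omega]
  exact P.letter_eq_iff e (u n).2.1 ((mem_regenSet_self.1 hg.1).2 n hmn le_rfl)
    fun i hi => P.runFrom_eq_pastAt e g₀ hg.1 hi

lemma mem_regenSet_shift (k m n : ℤ) :
    m ∈ P.regenSet (fun i => u (i + k)) n (n : WithTop ℤ) ↔
      m + k ∈ P.regenSet u (n + k) ((n + k : ℤ) : WithTop ℤ) := by
  rw [mem_regenSet_self, mem_regenSet_self]
  refine and_congr (by omega) ⟨fun h j hj hjn => ?_, fun h j hj hjn => ?_⟩
  · have := h (j - k) (by omega) (by omega)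
    rwa [sub_add_cancel, show j - k - m = j - (m + k) by ring] at this
  · have := h (j + k) (by omega) (by omega)
    rwa [show j + k - (m + k) = j - m by ring] at this

lemma runFrom_shift (k m : ℤ) (j : ℕ) :
    P.runFrom e g₀ (fun i => u (i + k)) m j = P.runFrom e g₀ u (m + k) j := by
  induction j with
  | zero => rfl
  | succ j ih =>
    funext i
    rcases i with _ | i
    · change P.letter e g₀ j (u (m + j + k)) _ = P.letter e g₀ j (u (m + k + j)) _
      rw [ih, show m + j + k = m + k + j by ring]
    · exact congrFun ih i

lemma Phi_shift (k n : ℤ) :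
    P.Phi e g₀ (fun i => u (i + k)) n = P.Phi e g₀ u (n + k) := by
  rcases (P.regenSet u (n + k) ((n + k : ℤ) : WithTop ℤ)).eq_empty_or_nonempty with he | ⟨m, hm⟩
  · rw [P.Phi_eq_of_eq_empty e g₀ he, P.Phi_eq_of_eq_empty e g₀]
    refine Set.eq_empty_of_forall_notMem fun x hx => ?_
    rw [P.mem_regenSet_shift, he] at hx
    exact hx
  · rw [P.Phi_eq_of_mem e g₀ hm, P.Phi_eq_of_mem e g₀ (m := m - k)
      ((P.mem_regenSet_shift _ _ _).2 (by rwa [sub_add_cancel])), runLetter, runLetter,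
      P.runFrom_shift, sub_add_cancel, show n - (m - k) = n + k - m by ring]
    congr 3
    ring

end TransitionKernel

/-! ### Independence of the uniform coordinates -/

instance isProbabilityMeasure_uniformSeqLaw : IsProbabilityMeasure uniformSeqLaw := by
  unfold uniformSeqLaw; infer_instance

lemma uniformSeqLaw_map_eval (N : ℤ) : uniformSeqLaw.map (fun u => u N) = uniformIco :=
  Measure.infinitePi_map_eval _ N

lemma uniformIco_apply {S : Set ℝ} (hS : S ⊆ Set.Ico 0 1) :
    uniformIco (Subtype.val ⁻¹' S) = volume S := by
  rw [uniformIco, comap_subtype_coe_apply measurableSet_Ico, Subtype.image_preimage_coe,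
    Set.inter_eq_right.2 hS]

lemma uniformSeqLaw_real_lt (N : ℤ) {c : ℝ} (h0 : 0 ≤ c) (h1 : c ≤ 1) :
    uniformSeqLaw.real {u | (u N : ℝ) < c} = c := by
  have hS : {u : ℤ → Set.Ico (0 : ℝ) 1 | (u N : ℝ) < c} =
      (fun u => u N) ⁻¹' (Subtype.val ⁻¹' Set.Ico 0 c) := by
    ext u; simp [(u N).2.1]
  rw [hS, Measure.real, ← Measure.map_apply (by fun_prop)
    (measurable_subtype_coe measurableSet_Ico), uniformSeqLaw_map_eval,
    uniformIco_apply (Set.Ico_subset_Ico_right h1), Real.volume_Ico, sub_zero,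
    ENNReal.toReal_ofReal h0]

/-- A function of the coordinates before time `N` is independent of the coordinate at time `N`. -/
lemma indepFun_of_forall_lt {E : Type*} [MeasurableSpace E] {F : (ℤ → Set.Ico (0 : ℝ) 1) → E}
    (hF : Measurable F) {N : ℤ} (h : ∀ u v, (∀ k < N, v k = u k) → F u = F v) :
    ProbabilityTheory.IndepFun F (fun u => u N) uniformSeqLaw := by
  have hind := ProbabilityTheory.iIndepFun_infinitePi (P := fun _ : ℤ => uniformIco)
    (X := fun _ x => x) (fun _ => measurable_id)
  have hsup := ProbabilityTheory.indep_iSup_of_disjoint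
    (S := Set.Iio N) (T := {N}) (fun k => (measurable_pi_apply k).comap_le) hind (by simp)
  refine ProbabilityTheory.indep_of_indep_of_le_left
    (ProbabilityTheory.indep_of_indep_of_le_right hsup ?_) ?_
  · exact le_iSup₂_of_le N rfl le_rfl
  · set z : Set.Ico (0 : ℝ) 1 := ⟨0, by simp⟩
    -- Freezing the coordinates from `N` on does not change `F`, so `F` is measurable for the
    -- σ-algebra of the earlier ones.
    have hcomp : F = F ∘ fun u k => if k < N then u k else z :=
      funext fun u => h _ _ fun k hk => by simp [hk]
    rw [hcomp, ← MeasurableSpace.comap_comp]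
    refine (MeasurableSpace.comap_mono hF.comap_le).trans ?_
    rw [← measurable_iff_comap_le]
    refine @measurable_pi_lambda _ _ _ (_) _ _ fun k => ?_
    by_cases hk : k < N
    · simp only [hk, if_true]
      rw [measurable_iff_comap_le]
      exact le_iSup₂_of_le k hk le_rfl
    · simp only [hk, if_false]
      exact measurable_const

/-! ### The house-of-cards chain driven by the uniforms -/

section Chain

variable (a : ℕ → ℝ)

/-- The house-of-cards chain driven by `u`, at time `m + n`, started from the origin at time `m`. -/
def houseChain (u : ℤ → Set.Ico (0 : ℝ) 1) (m : ℤ) : ℕ → ℕ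
  | 0 => 0
  | n + 1 => if (u (m + n + 1) : ℝ) < a (houseChain u m n) then houseChain u m n + 1 else 0

variable {a} {u v : ℤ → Set.Ico (0 : ℝ) 1} {m : ℤ}

lemma houseChain_succ (m : ℤ) (n : ℕ) : houseChain a u m (n + 1) =
    if (u (m + n + 1) : ℝ) < a (houseChain a u m n) then houseChain a u m n + 1 else 0 := rfl

lemma houseChain_le (n : ℕ) : houseChain a u m n ≤ n := by
  induction n with
  | zero => exact le_rfl
  | succ n ih => rw [houseChain]; split_ifs <;> omega

lemma houseChain_congr {n : ℕ} (h : ∀ k : ℤ, k ≤ m + n → v k = u k) :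
    houseChain a u m n = houseChain a v m n := by
  induction n with
  | zero => rfl
  | succ n ih =>
    rw [houseChain, houseChain, ih fun k hk => h k (by push_cast; omega),
      h (m + n + 1) (by push_cast; omega)]

lemma measurable_houseChain (m : ℤ) (n : ℕ) : Measurable fun u => houseChain a u m n := by
  induction n with
  | zero => exact measurable_const
  | succ n ih =>
    refine Measurable.ite (measurableSet_lt (by fun_prop) ?_) ?_ measurable_const
    · exact (measurable_from_nat (f := a)).comp ih
    · exact (measurable_from_nat (f := fun k => k + 1)).comp ih

/-- Coupling: when the later-started, lower chain climbs, the higher one climbs too, because `a` is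
monotone. -/
lemma houseChain_mono_start (ha : Monotone a) (n : ℕ) :
    houseChain a u (m + 1) n ≤ houseChain a u m (n + 1) := by
  induction n with
  | zero => exact Nat.zero_le _
  | succ n ih =>
    rw [houseChain_succ, houseChain_succ m (n + 1), show m + ((n + 1 : ℕ) : ℤ) + 1 = m + 1 + n + 1 by push_cast; ring]
    by_cases h : (u (m + 1 + n + 1) : ℝ) < a (houseChain a u (m + 1) n)
    · rw [if_pos h, if_pos (h.trans_le (ha ih))]
      omega
    · rw [if_neg h]
      exact Nat.zero_le _

lemma uniformSeqLaw_real_inter (m : ℤ) (n y : ℕ) {S : Set (Set.Ico (0 : ℝ) 1)}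
    (hS : MeasurableSet S) :
    uniformSeqLaw.real ({u | houseChain a u m n = y} ∩ {u | u (m + n + 1) ∈ S}) =
      uniformSeqLaw.real {u | houseChain a u m n = y} *
        uniformSeqLaw.real {u | u (m + n + 1) ∈ S} := by
  have hind := indepFun_of_forall_lt (measurable_houseChain (a := a) m n) (N := m + n + 1)
    fun u v h => houseChain_congr fun k hk => h k (by omega)
  have := hind.measure_inter_preimage_eq_mul {y} S (measurableSet_singleton y) hS
  rw [Measure.real, Measure.real, Measure.real, ← ENNReal.toReal_mul]
  exact congrArg ENNReal.toReal this

lemma houseChain_law (h0 : ∀ k, 0 ≤ a k) (h1 : ∀ k, a k ≤ 1) (m : ℤ) (n y : ℕ) :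
    uniformSeqLaw.real {u | houseChain a u m n = y} = houseOfCardsLaw a n y := by
  have hlt : ∀ c : ℝ, MeasurableSet {x : Set.Ico (0 : ℝ) 1 | (x : ℝ) < c} := fun c =>
    measurableSet_lt measurable_subtype_coe measurable_const
  induction n generalizing y with
  | zero =>
    rcases y with _ | y <;> simp [houseChain, houseOfCardsLaw]
  | succ n ih =>
    rcases y with _ | y
    · rw [houseOfCardsLaw_succ_zero]
      have hS : {u | houseChain a u m (n + 1) = 0} = ⋃ x ∈ Finset.range (n + 1),
          {u | houseChain a u m n = x} ∩ {u | u (m + n + 1) ∈ {x' : Set.Ico (0 : ℝ) 1 | (x' : ℝ) < a x}ᶜ} := by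
        ext u
        have := houseChain_le (a := a) (u := u) (m := m) n
        simp [houseChain, this]
      rw [hS, measureReal_biUnion_finset]
      · refine Finset.sum_congr rfl fun x _ => ?_
        rw [uniformSeqLaw_real_inter m n x (hlt _).compl, ih]
        congr 1
        have hcompl := probReal_compl_eq_one_sub (μ := uniformSeqLaw)
          (s := {u | (u (m + n + 1) : ℝ) < a x})
          (measurableSet_lt (by fun_prop) measurable_const)
        rw [uniformSeqLaw_real_lt _ (h0 x) (h1 x)] at hcompl
        exact hcompl
      · intro x _ x' _ hne
        refine Set.disjoint_left.2 fun u hu hu' => hne (hu.1.symm.trans hu'.1)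
      · intro x _
        exact (measurable_houseChain m n (measurableSet_singleton x)).inter
          (measurable_pi_apply _ (hlt _).compl)
    · rw [houseOfCardsLaw_succ_succ]
      have hS : {u | houseChain a u m (n + 1) = y + 1} =
          {u | houseChain a u m n = y} ∩ {u | u (m + n + 1) ∈ {x' : Set.Ico (0 : ℝ) 1 | (x' : ℝ) < a y}} := by
        ext u
        simp only [houseChain, Set.mem_ofPred_eq, Set.mem_inter_iff]
        split_ifs with h
        · rw [Nat.add_right_cancel_iff]
          exact ⟨fun hy => ⟨hy, hy ▸ h⟩, fun hy => hy.1⟩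
        · exact ⟨False.elim, fun hy => absurd (hy.1 ▸ hy.2) h⟩
      rw [hS, uniformSeqLaw_real_inter m n y (hlt _), ih]
      congr 1
      exact uniformSeqLaw_real_lt _ (h0 y) (h1 y)

/-- Compare, at the same instant, the chains started at times `0` and `1`: if the older, higher one
is at `0`, so is the younger. -/
lemma antitone_returnProb (h0 : ∀ k, 0 ≤ a k) (h1 : ∀ k, a k ≤ 1) (ha : Monotone a) :
    Antitone fun n => houseOfCardsLaw a n 0 := antitone_nat_of_succ_le fun n => by
  rw [← houseChain_law h0 h1 0 (n + 1) 0, ← houseChain_law h0 h1 (0 + 1) n 0]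
  refine measureReal_mono fun u hu => ?_
  exact Nat.le_zero.1 ((houseChain_mono_start ha n).trans_eq hu)

lemma houseChain_add_eq {j K : ℕ} (hj : houseChain a u m j = 0)
    (h : ∀ i < K, houseChain a u m (j + i + 1) ≠ 0) {i : ℕ} (hi : i ≤ K) :
    houseChain a u m (j + i) = i := by
  induction i with
  | zero => exact hj
  | succ i ih =>
    have := h i hi
    rw [← add_assoc, houseChain]
    rw [houseChain] at this
    split_ifs at this ⊢ with hlt
    · rw [ih (by omega)]
    · exact absurd rfl this

end Chain

/-! ### Tail of the regeneration time -/

namespace TransitionKernel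

variable {G : Type*} (P : TransitionKernel G)

/-- Let `j` index the last zero of the chain before time `s`. From there on the chain only climbs,
so its height is its age (`houseChain_add_eq`), and the climbing conditions are exactly those
defining `regenSet` at the next instant. Positivity of `m` puts the starting zero strictly before
`s`. -/
lemma exists_mem_regenSet {u : ℤ → Set.Ico (0 : ℝ) 1} {s : ℤ} {t : WithTop ℤ} {m : ℕ} (hm : 0 < m)
    (h : ∀ i : ℕ, ((s + i : ℤ) : WithTop ℤ) ≤ t → houseChain P.a u (s - m) (m + i) ≠ 0) :
    ∃ x ∈ P.regenSet u s t, s - m ≤ x := by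
  set W := houseChain P.a u (s - m) with hW
  set j := Nat.findGreatest (fun j => W j = 0) (m - 1) with hj
  have hj0 : W j = 0 := Nat.findGreatest_spec (P := fun j => W j = 0) (Nat.zero_le _) rfl
  have hjm : j ≤ m - 1 := Nat.findGreatest_le _
  have hne : ∀ n : ℕ, j < n → ((s - m + n : ℤ) : WithTop ℤ) ≤ t → W n ≠ 0 := by
    intro n hn hnt
    rcases le_or_gt n (m - 1) with hle | hgt
    · exact Nat.findGreatest_is_greatest (P := fun j => W j = 0) hn hle
    · have := h (n - m) (by rwa [show s + ((n - m : ℕ) : ℤ) = s - m + n by omega])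
      rwa [show m + (n - m) = n by omega] at this
  refine ⟨s - m + j + 1, ⟨by omega, fun k hk hkt => ?_⟩, by omega⟩
  obtain ⟨i, rfl⟩ : ∃ i : ℕ, k = s - m + (j + i : ℕ) + 1 :=
    ⟨(k - (s - m + j + 1)).toNat, by push_cast; omega⟩
  have hWi : ∀ i' ≤ i, W (j + i' + 1) ≠ 0 := fun i' hi' =>
    hne _ (by omega) (le_trans (WithTop.coe_le_coe.2 (by push_cast; omega)) hkt)
  have hlast := hWi i le_rfl
  rw [hW, houseChain, houseChain_add_eq hj0 (fun i' hi' => hWi i' hi'.le) le_rfl] at hlast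
  rw [show (s - m + (j + i : ℕ) + 1 - (s - m + j + 1) : ℤ).toNat = i by push_cast; omega]
  by_contra hlt
  exact hlast (if_neg hlt)

lemma setOf_tau_lt_subset {s : ℤ} {t : WithTop ℤ} {m : ℕ} (hm : 0 < m) :
    {u | P.tau u s t < ((s - m : ℤ) : WithBot ℤ)} ⊆
      {u | ∃ i : ℕ, ((s + i : ℤ) : WithTop ℤ) ≤ t ∧ houseChain P.a u (s - m) (m + i) = 0} := by
  intro u hu
  by_contra hcon
  simp only [Set.mem_ofPred_eq, not_exists, not_and] at hcon
  obtain ⟨x, hx, hle⟩ := P.exists_mem_regenSet hm hcon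
  exact absurd (tau_lt_coe_iff.1 hu x hx) (not_lt.2 hle)

variable [Nonempty G]

lemma rho_nonneg (n : ℕ) : 0 ≤ P.rho n := houseOfCardsLaw_nonneg P.a_nonneg P.a_le_one n 0

omit [Nonempty G] in
lemma rho_zero : P.rho 0 = 1 := houseOfCardsLaw_zero_zero _

lemma uniformSeqLaw_real_houseChain (m : ℤ) (n : ℕ) :
    uniformSeqLaw.real {u | houseChain P.a u m n = 0} = P.rho n :=
  houseChain_law P.a_nonneg P.a_le_one m n 0

lemma uniformSeqLaw_real_tau_lt {s t : ℤ} (m : ℕ) :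
    uniformSeqLaw.real {u | P.tau u s (t : WithTop ℤ) < ((s - m : ℤ) : WithBot ℤ)} ≤
      ∑ i ∈ Finset.range ((t - s).toNat + 1), P.rho (m + i) := by
  -- For `m = 0` the bound is trivial, since the sum contains `ρ_0 = 1`.
  rcases Nat.eq_zero_or_pos m with rfl | hm
  · refine measureReal_le_one.trans ?_
    rw [← P.rho_zero]
    exact Finset.single_le_sum (f := fun i => P.rho (0 + i)) (fun i _ => P.rho_nonneg _)
      (Finset.mem_range.2 (Nat.succ_pos _))
  · simp_rw [← P.uniformSeqLaw_real_houseChain (s - m)]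
    refine le_trans (measureReal_mono ((P.setOf_tau_lt_subset hm).trans ?_)
      (measure_ne_top _ _)) (measureReal_biUnion_finset_le _ _)
    rintro u ⟨i, hi, hu⟩
    rw [WithTop.coe_le_coe] at hi
    exact Set.mem_biUnion (Finset.mem_coe.2 (Finset.mem_range.2 (by omega))) hu

lemma uniformSeqLaw_real_tau_top_lt (hρ : Summable P.rho) {s : ℤ} (m : ℕ) :
    uniformSeqLaw.real {u | P.tau u s ⊤ < ((s - m : ℤ) : WithBot ℤ)} ≤ ∑' i, P.rho (m + i) := by
  have hρ' : Summable fun i => P.rho (m + i) := by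
    simpa only [add_comm m] using (summable_nat_add_iff m).2 hρ
  rcases Nat.eq_zero_or_pos m with rfl | hm
  · refine measureReal_le_one.trans ?_
    rw [← P.rho_zero]
    exact hρ'.le_tsum 0 fun i _ => P.rho_nonneg _
  · rw [Measure.real]
    refine ENNReal.toReal_le_of_le_ofReal (tsum_nonneg fun _ => P.rho_nonneg _) ?_
    rw [ENNReal.ofReal_tsum_of_nonneg (fun _ => P.rho_nonneg _) hρ']
    refine (measure_mono ((P.setOf_tau_lt_subset hm).trans ?_)).trans
      ((measure_iUnion_le fun i => {u | houseChain P.a u (s - m) (m + i) = 0}).trans_eq ?_)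
    · rintro u ⟨i, -, hu⟩
      exact Set.mem_iUnion.2 ⟨i, hu⟩
    · refine tsum_congr fun i => ?_
      rw [← P.uniformSeqLaw_real_houseChain (s - m), ofReal_measureReal]

omit [Nonempty G] in
lemma ae_tau_ne_bot {s : ℤ} {t : WithTop ℤ} {f : ℕ → ℝ} (hf : Tendsto f atTop (𝓝 0))
    (h : ∀ m : ℕ, uniformSeqLaw.real {u | P.tau u s t < ((s - m : ℤ) : WithBot ℤ)} ≤ f m) :
    ∀ᵐ u ∂uniformSeqLaw, P.tau u s t ≠ ⊥ := by
  have h0 : uniformSeqLaw.real {u | P.tau u s t = ⊥} ≤ 0 :=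
    ge_of_tendsto' hf fun m => (measureReal_mono (fun u hu => by
      rw [Set.mem_ofPred_eq] at hu ⊢
      rw [hu]; exact WithBot.bot_lt_coe _) (measure_ne_top _ _)).trans (h m)
  have h1 := le_antisymm h0 measureReal_nonneg
  rw [measureReal_eq_zero_iff] at h1
  rw [ae_iff]
  simpa using h1

lemma tendsto_rho_zero
    (hβ : Tendsto (fun n => ∑ m ∈ Finset.range n, P.betaProd m) atTop atTop) :
    Tendsto P.rho atTop (𝓝 0) := by
  refine tendsto_returnProb_zero P.a_nonneg P.a_le_one
    (antitone_returnProb P.a_nonneg P.a_le_one P.a_mono) ?_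
  rw [← tendsto_add_atTop_iff_nat 1]
  simp_rw [Finset.sum_range_succ']
  exact tendsto_atTop_add_const_right _ _ hβ

lemma ae_tau_coe_ne_bot
    (hβ : Tendsto (fun n => ∑ m ∈ Finset.range n, P.betaProd m) atTop atTop) (s t : ℤ) :
    ∀ᵐ u ∂uniformSeqLaw, P.tau u s (t : WithTop ℤ) ≠ ⊥ := by
  refine P.ae_tau_ne_bot (f := fun m => ∑ i ∈ Finset.range ((t - s).toNat + 1), P.rho (m + i)) ?_
    fun m => P.uniformSeqLaw_real_tau_lt m
  rw [← Finset.sum_const_zero (s := Finset.range ((t - s).toNat + 1))]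
  exact tendsto_finsetSum _ fun i _ =>
    (tendsto_add_atTop_iff_nat i).2 (P.tendsto_rho_zero hβ)

lemma ae_tau_top_ne_bot (hρ : Summable P.rho) (s : ℤ) :
    ∀ᵐ u ∂uniformSeqLaw, P.tau u s ⊤ ≠ ⊥ := by
  refine P.ae_tau_ne_bot (f := fun m => ∑' i, P.rho (m + i)) ?_
    fun m => P.uniformSeqLaw_real_tau_top_lt hρ m
  simpa only [add_comm] using tendsto_sum_nat_add P.rho

end TransitionKernel

/-! ### Measurability of the construction -/

lemma measurable_of_forall_lt_eq {G E : Type*} [Countable G] [MeasurableSpace G]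
    [MeasurableSingletonClass G] [MeasurableSpace E] (f : (ℕ → G) → E) (k : ℕ)
    (h : ∀ w w', (∀ i < k, w i = w' i) → f w = f w') : Measurable f := by
  rcases isEmpty_or_nonempty G with hG | ⟨⟨g₀⟩⟩
  · have : IsEmpty (ℕ → G) := ⟨fun w => hG.elim (w 0)⟩
    exact measurable_of_empty f
  have hf : f = (fun x : Fin k → G => f fun i => if hi : i < k then x ⟨i, hi⟩ else g₀) ∘
      fun w i => w i := by
    funext w
    exact h _ _ fun i hi => by simp [hi]
  rw [hf]
  exact (measurable_of_countable _).comp (by fun_prop)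

namespace TransitionKernel

variable {G : Type*} [MeasurableSpace G] [DiscreteMeasurableSpace G]
  (P : TransitionKernel G) (e : G ↪ ℕ) (g₀ : G)

omit [MeasurableSpace G] [DiscreteMeasurableSpace G] in
lemma measurableSet_B (k : ℕ) (g : G) (w : ℕ → G) : MeasurableSet (P.B e k g w) :=
  measurableSet_Ico

include e in
lemma measurable_b (k : ℕ) (g : G) : Measurable (P.b k g) :=
  have := e.injective.countable
  measurable_of_forall_lt_eq _ k fun _ _ h => P.b_congr h g

lemma measurable_leftEnd (k : ℕ) (g : G) : Measurable (P.leftEnd e k g) :=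
  have := e.injective.countable
  measurable_of_forall_lt_eq _ k fun _ _ h => P.leftEnd_congr e h g

include e in
-- Measurability is not part of the definition of the kernel; it comes from approximation by
-- functions of finitely many symbols of a countable alphabet.
lemma measurable_prob (ha : Tendsto P.a atTop (𝓝 1)) (g : G) : Measurable (P.prob g) :=
  have := e.injective.countable
  measurable_of_tendsto_metrizable (f := fun k => P.aCond k g)
    (fun k => measurable_of_forall_lt_eq _ k fun _ _ h => P.aCond_congr h g)
    (tendsto_pi_nhds.2 fun w => P.tendsto_aCond ha g w)

omit [DiscreteMeasurableSpace G] in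
lemma measurable_letter_left (k : ℕ) (w : ℕ → G) :
    Measurable fun x : ℝ => P.letter e g₀ k x w := by
  have := e.injective.countable
  have hm : ∀ g, MeasurableSet {x | ∃ l ≤ k, x ∈ P.BTrunc e l k g w} := fun g => by
    have : {x | ∃ l ≤ k, x ∈ P.BTrunc e l k g w} = ⋃ l, ⋃ _ : l ≤ k, P.BTrunc e l k g w := by
      ext x; simp
    rw [this]
    exact MeasurableSet.iUnion fun l => MeasurableSet.iUnion fun _ =>
      measurableSet_Ico.inter (P.measurableSet_B e l g w)
  refine measurable_to_countable' fun g => ?_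
  have : (fun x : ℝ => P.letter e g₀ k x w) ⁻¹' {g} =
      {x | ∃ l ≤ k, x ∈ P.BTrunc e l k g w} ∪
        ((⋃ g', {x | ∃ l ≤ k, x ∈ P.BTrunc e l k g' w})ᶜ ∩ {_x | g₀ = g}) := by
    ext x
    simp only [Set.mem_preimage, Set.mem_singleton_iff, Set.mem_union, Set.mem_inter_iff,
      Set.mem_compl_iff, Set.mem_iUnion, Set.mem_ofPred_eq]
    by_cases hex : ∃ g, ∃ l ≤ k, x ∈ P.BTrunc e l k g w
    · have hex' := hex
      obtain ⟨g', l, hl, h⟩ := hex'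
      rw [P.letter_eq_of_mem e hl h]
      refine ⟨fun hg => Or.inl ⟨l, hl, hg ▸ h⟩, ?_⟩
      rintro (⟨l', hl', h'⟩ | h')
      · exact (P.B_index_unique e h.2 h'.2).2
      · exact absurd hex h'.1
    · rw [letter, dif_neg hex]
      exact ⟨fun hg => Or.inr ⟨hex, hg⟩, fun h => h.elim (fun h => absurd ⟨g, h⟩ hex) fun h => h.2⟩
  rw [this]
  exact (hm g).union ((MeasurableSet.iUnion hm).compl.inter (MeasurableSet.const _))

lemma measurable_letter (k : ℕ) :
    Measurable fun p : ℝ × (ℕ → G) => P.letter e g₀ k p.1 p.2 := by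
  have := e.injective.countable
  have hr : Measurable fun (w : ℕ → G) (i : Fin k) => w i :=
    measurable_pi_lambda _ fun _ => measurable_pi_apply _
  have hpair : Measurable fun p : ℝ × (ℕ → G) => (p.1, fun i : Fin k => p.2 i) :=
    measurable_fst.prodMk (hr.comp measurable_snd)
  have hq : Measurable fun q : ℝ × (Fin k → G) =>
      P.letter e g₀ k q.1 fun i => if hi : i < k then q.2 ⟨i, hi⟩ else g₀ :=
    measurable_from_prod_countable_left fun y =>
      P.measurable_letter_left e g₀ k fun i => if hi : i < k then y ⟨i, hi⟩ else g₀
  have hcomp := Measurable.comp (f := fun p : ℝ × (ℕ → G) => (p.1, fun i : Fin k => p.2 i))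
    (g := fun q : ℝ × (Fin k → G) =>
      P.letter e g₀ k q.1 fun i => if hi : i < k then q.2 ⟨i, hi⟩ else g₀) hq hpair
  refine (congrArg Measurable (funext fun p => ?_)).mp hcomp
  exact P.letter_congr_history e fun i hi => by simp [hi]

lemma measurable_letter_comp (k : ℕ) (N : ℤ) {F : (ℤ → Set.Ico (0 : ℝ) 1) → ℕ → G}
    (hF : Measurable F) : Measurable fun u => P.letter e g₀ k (u N) (F u) := by
  have hu : Measurable fun u : ℤ → Set.Ico (0 : ℝ) 1 => (u N : ℝ) :=
    measurable_subtype_coe.comp (measurable_pi_apply N)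
  have h : Measurable fun u => ((u N : ℝ), F u) := hu.prodMk hF
  exact Measurable.comp (g := fun p : ℝ × (ℕ → G) => P.letter e g₀ k p.1 p.2)
    (f := fun u => ((u N : ℝ), F u)) (P.measurable_letter e g₀ k) h

lemma measurable_runFrom (m : ℤ) (k : ℕ) : Measurable fun u => P.runFrom e g₀ u m k := by
  induction k with
  | zero => exact measurable_const
  | succ k ih =>
    refine measurable_pi_lambda _ fun i => ?_
    rcases i with _ | i
    · exact P.measurable_letter_comp e g₀ k (m + k) ih
    · exact measurable_pi_iff.1 ih i

lemma measurable_runLetter (m : ℤ) (k : ℕ) : Measurable fun u => P.runLetter e g₀ u m k :=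
  P.measurable_letter_comp e g₀ k (m + k) (P.measurable_runFrom e g₀ m k)

omit [MeasurableSpace G] [DiscreteMeasurableSpace G] in
lemma measurableSet_mem_regenSet (m n : ℤ) :
    MeasurableSet {u | m ∈ P.regenSet u n (n : WithTop ℤ)} := by
  have : {u | m ∈ P.regenSet u n (n : WithTop ℤ)} =
      {_u | m ≤ n} ∩ ⋂ k : ℤ, ⋂ _ : m ≤ k, ⋂ _ : k ≤ n, {u | (u k : ℝ) < P.a (k - m).toNat} := by
    ext u; simp [mem_regenSet_self]
  rw [this]
  exact (MeasurableSet.const _).inter (MeasurableSet.iInter fun k => MeasurableSet.iInter fun _ =>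
    MeasurableSet.iInter fun _ => measurableSet_lt
      (measurable_subtype_coe.comp (measurable_pi_apply k)) measurable_const)

lemma measurable_Phi : Measurable (P.Phi e g₀) := by
  have := e.injective.countable
  refine measurable_pi_lambda _ fun n => measurable_to_countable' fun g => ?_
  -- The union runs over all regeneration times, not only the last; the pieces overlap consistently
  -- by `Phi_eq_of_mem`.
  have : (fun u => P.Phi e g₀ u n) ⁻¹' {g} =
      (⋃ m, {u | m ∈ P.regenSet u n (n : WithTop ℤ)} ∩
        (fun u => P.runLetter e g₀ u m (n - m).toNat) ⁻¹' {g}) ∪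
      ((⋃ m, {u | m ∈ P.regenSet u n (n : WithTop ℤ)})ᶜ ∩ {_u | g₀ = g}) := by
    ext u
    simp only [Set.mem_preimage, Set.mem_singleton_iff, Set.mem_union, Set.mem_inter_iff,
      Set.mem_compl_iff, Set.mem_iUnion, Set.mem_ofPred_eq]
    rcases (P.regenSet u n (n : WithTop ℤ)).eq_empty_or_nonempty with he | ⟨m, hm⟩
    · simp [P.Phi_eq_of_eq_empty e g₀ he, he]
    · refine ⟨fun h => Or.inl ⟨m, hm, (P.Phi_eq_of_mem e g₀ hm).symm.trans h⟩, ?_⟩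
      rintro (⟨m', hm', h⟩ | h)
      · exact (P.Phi_eq_of_mem e g₀ hm').trans h
      · exact absurd ⟨m, hm⟩ h.1
  rw [this]
  exact (MeasurableSet.iUnion fun m => (P.measurableSet_mem_regenSet m n).inter
    (P.measurable_runLetter e g₀ m _ (measurableSet_singleton g))).union
    ((MeasurableSet.iUnion fun m => P.measurableSet_mem_regenSet m n).compl.inter
      (MeasurableSet.const _))

/-! ### Stationarity and compatibility of the law -/

lemma isStationaryLaw_map_Phi : IsStationaryLaw (uniformSeqLaw.map (P.Phi e g₀)) := by
  intro k
  have hshift : uniformSeqLaw.map (fun u i => u (i + k)) = uniformSeqLaw :=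
    Measure.map_infinitePi_infinitePi_of_inj (P := fun _ : ℤ => uniformIco)
      (f := fun i : ℤ => i + k) (add_left_injective k)
  conv_rhs => rw [← hshift]
  rw [Measure.map_map (by fun_prop) (P.measurable_Phi e g₀),
    Measure.map_map (P.measurable_Phi e g₀) (by fun_prop)]
  congr 1
  funext u n
  exact (P.Phi_shift e g₀ k n).symm

omit [DiscreteMeasurableSpace G] in
lemma measurable_pastAt (i : ℤ) : Measurable (pastAt i : (ℤ → G) → ℕ → G) :=
  measurable_pi_lambda _ fun _ => measurable_pi_apply _

omit [MeasurableSpace G] [DiscreteMeasurableSpace G] in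
lemma uniformIco_iUnion_B (ha : Tendsto P.a atTop (𝓝 1)) (g : G) (w : ℕ → G) :
    uniformIco (Subtype.val ⁻¹' ⋃ l, P.B e l g w) = ENNReal.ofReal (P.prob g w) := by
  have hs := P.hasSum_b ha g w
  rw [uniformIco_apply (Set.iUnion_subset fun l => P.B_subset_Ico e l g w), measure_iUnion,
    ← hs.tsum_eq, ENNReal.ofReal_tsum_of_nonneg (fun l => P.b_nonneg l g w) hs.summable]
  · exact tsum_congr fun l => by rw [B, Real.volume_Ico, add_sub_cancel_left]
  · exact fun l l' hne => Set.disjoint_left.2 fun x hx hx' => hne (P.B_index_unique e hx hx').1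
  · exact fun l => measurableSet_Ico

/-- The conditional law of `Φ(U)(i)` given the past of `Φ(U)`, in integrated form. -/
lemma lintegral_prob_pastAt (ha : Tendsto P.a atTop (𝓝 1)) (i : ℤ)
    (hτ : ∀ᵐ u ∂uniformSeqLaw, P.tau u i (i : WithTop ℤ) ≠ ⊥) (g : G)
    {A : Set (ℕ → G)} (hA : MeasurableSet A) :
    ∫⁻ η in pastAt i ⁻¹' A, ENNReal.ofReal (P.prob g (pastAt i η))
        ∂(uniformSeqLaw.map (P.Phi e g₀)) =
      uniformSeqLaw.map (P.Phi e g₀) (pastAt i ⁻¹' A ∩ {η | η i = g}) := by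
  have hΦ := P.measurable_Phi e g₀
  set X : (ℤ → Set.Ico (0 : ℝ) 1) → ℕ → G := fun u => pastAt i (P.Phi e g₀ u) with hX
  have hXm : Measurable X := (measurable_pastAt i).comp hΦ
  have hind := indepFun_of_forall_lt hXm (N := i) fun u v h => funext fun j =>
    P.Phi_congr_of_forall_le e g₀ fun k hk => h k (by omega)
  -- The past `X` of `Phi` before `i` depends only on coordinates before `i`, so its joint law with
  -- `u i` is a product. Fubini then replaces the section of `S` at `w` by its length `P(g | w)`.
  have hprod : uniformSeqLaw.map (fun u => (X u, u i)) = (uniformSeqLaw.map X).prod uniformIco := by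
    rw [← uniformSeqLaw_map_eval i]
    exact (ProbabilityTheory.indepFun_iff_map_prod_eq_prod_map_map hXm.aemeasurable
      (measurable_pi_apply i).aemeasurable).1 hind
  set S : Set ((ℕ → G) × Set.Ico (0 : ℝ) 1) :=
    Prod.fst ⁻¹' A ∩ ⋃ l, {p | (p.2 : ℝ) ∈ P.B e l g p.1} with hS
  have hSm : MeasurableSet S := by
    refine (measurable_fst hA).inter (MeasurableSet.iUnion fun l => ?_)
    have hfst : Measurable (Prod.fst : (ℕ → G) × Set.Ico (0 : ℝ) 1 → ℕ → G) := measurable_fst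
    have h1 : Measurable fun p : (ℕ → G) × Set.Ico (0 : ℝ) 1 => P.leftEnd e l g p.1 :=
      (P.measurable_leftEnd e l g).comp hfst
    have h2 : Measurable fun p : (ℕ → G) × Set.Ico (0 : ℝ) 1 => P.b l g p.1 :=
      (P.measurable_b e l g).comp hfst
    have h3 : Measurable fun p : (ℕ → G) × Set.Ico (0 : ℝ) 1 => (p.2 : ℝ) :=
      measurable_subtype_coe.comp measurable_snd
    exact (measurableSet_le h1 h3).inter (measurableSet_lt h3 (h1.add h2))
  have hsingle : MeasurableSet {η : ℤ → G | η i = g} :=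
    (measurable_pi_apply i : Measurable fun η : ℤ → G => η i) (measurableSet_singleton g)
  calc ∫⁻ η in pastAt i ⁻¹' A, ENNReal.ofReal (P.prob g (pastAt i η))
        ∂(uniformSeqLaw.map (P.Phi e g₀))
      = ∫⁻ w in A, ENNReal.ofReal (P.prob g w) ∂(uniformSeqLaw.map X) := by
        rw [show uniformSeqLaw.map X = (uniformSeqLaw.map (P.Phi e g₀)).map (pastAt i) from
          (Measure.map_map (measurable_pastAt i) hΦ).symm,
          setLIntegral_map hA (P.measurable_prob e ha g).ennreal_ofReal (measurable_pastAt i)]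
    _ = (uniformSeqLaw.map X).prod uniformIco S := by
        rw [Measure.prod_apply hSm, ← lintegral_indicator hA]
        refine lintegral_congr fun w => ?_
        by_cases hw : w ∈ A
        · rw [Set.indicator_of_mem hw, ← P.uniformIco_iUnion_B e ha g w]
          congr 1
          ext x
          simp [hS, hw]
        · rw [Set.indicator_of_notMem hw]
          have : Prod.mk w ⁻¹' S = ∅ := by
            ext x; simp [hS, hw]
          rw [this, measure_empty]
    _ = uniformSeqLaw.map (P.Phi e g₀) (pastAt i ⁻¹' A ∩ {η | η i = g}) := by
        rw [← hprod, Measure.map_apply (hXm.prodMk (measurable_pi_apply i)) hSm,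
          Measure.map_apply hΦ ((measurable_pastAt i hA).inter hsingle)]
        -- The two events agree only where the regeneration time is finite: elsewhere `Phi` takes
        -- the default value `g₀`.
        refine measure_congr ?_
        filter_upwards [hτ] with u hu
        have := P.Phi_eq_iff e g₀ hu g
        refine propext ?_
        change (X u ∈ A ∧ _) ↔ (X u ∈ A ∧ P.Phi e g₀ u i = g)
        rw [this, Set.mem_iUnion, Set.mem_iUnion]
        rfl

lemma compatible_map_Phi (ha : Tendsto P.a atTop (𝓝 1))
    (hτ : ∀ i : ℤ, ∀ᵐ u ∂uniformSeqLaw, P.tau u i (i : WithTop ℤ) ≠ ⊥) :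
    P.Compatible (uniformSeqLaw.map (P.Phi e g₀)) := by
  have hΦ := P.measurable_Phi e g₀
  have hν : IsProbabilityMeasure (uniformSeqLaw.map (P.Phi e g₀)) :=
    Measure.isProbabilityMeasure_map hΦ.aemeasurable
  refine ⟨hν, fun i g => ?_⟩
  set ν := uniformSeqLaw.map (P.Phi e g₀)
  have hsingle : MeasurableSet {η : ℤ → G | η i = g} :=
    (measurable_pi_apply i : Measurable fun η : ℤ → G => η i) (measurableSet_singleton g)
  have hprobm := P.measurable_prob e ha g
  have hle : ∀ w, P.prob g w ≤ 1 := fun w =>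
    (P.hasSum_prob w).tsum_eq ▸ (P.hasSum_prob w).summable.le_tsum g fun j _ => P.prob_nonneg j w
  have hint : Integrable (fun η => P.prob g (pastAt i η)) ν :=
    Integrable.of_bound (hprobm.comp (measurable_pastAt i)).aestronglyMeasurable 1
      (Eventually.of_forall fun η => by
        rw [Real.norm_of_nonneg (P.prob_nonneg _ _)]; exact hle _)
  symm
  refine ae_eq_condExp_of_forall_setIntegral_eq (measurable_pastAt i).comap_le
    ((integrable_const (1 : ℝ)).indicator hsingle) (fun s _ _ => hint.integrableOn) ?_
    ((hprobm.comp (comap_measurable (pastAt i))).aestronglyMeasurable)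
  rintro _ ⟨A, hA, rfl⟩ -
  rw [setIntegral_indicator hsingle, setIntegral_const, smul_eq_mul, mul_one, Measure.real,
    ← P.lintegral_prob_pastAt e g₀ ha i (hτ i) g hA, integral_eq_lintegral_of_nonneg_ae
      (Eventually.of_forall fun η => P.prob_nonneg _ _) hint.aestronglyMeasurable.restrict]

end TransitionKernel

end

theorem theorem4p1 {G : Type*} [MeasurableSpace G] [DiscreteMeasurableSpace G]
    (e : G ↪ ℕ) (g₀ : G) (P : TransitionKernel G)
    (hβ : Tendsto (fun n => ∑ m ∈ Finset.range n, P.betaProd m) atTop atTop) :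
    -- (i)
    (∀ s t : ℤ, s ≤ t → ∀ᵐ u ∂uniformSeqLaw, P.tau u s (t : WithTop ℤ) ≠ ⊥) ∧
    -- (ii)
    (Measurable (P.Phi e g₀) ∧
      P.Compatible (uniformSeqLaw.map (P.Phi e g₀)) ∧
      IsStationaryLaw (uniformSeqLaw.map (P.Phi e g₀))) ∧
    -- (iii)
    (∀ s t : ℤ, s ≤ t → ∀ u v : ℤ → Set.Ico (0 : ℝ) 1,
      (∀ k : ℤ, P.tau u s (t : WithTop ℤ) ≤ (k : WithBot ℤ) → k ≤ t → v k = u k) →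
      ∀ i : ℤ, s ≤ i → i ≤ t → P.Phi e g₀ u i = P.Phi e g₀ v i) ∧
    -- (iv)
    ((∀ s t : ℤ, s ≤ t → ∀ m : ℕ,
        uniformSeqLaw.real {u | P.tau u s (t : WithTop ℤ) < ((s - m : ℤ) : WithBot ℤ)}
          ≤ ∑ i ∈ Finset.range ((t - s).toNat + 1), P.rho (m + i)) ∧
      ((∃ C r : ℝ, 0 < r ∧ r < 1 ∧ ∀ k : ℕ, 1 - P.a k ≤ C * r ^ k) →
        ∃ C r : ℝ, 0 < r ∧ r < 1 ∧ ∀ k : ℕ, P.rho k ≤ C * r ^ k) ∧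
      (∀ γ : ℝ, 1 < γ →
        (fun k : ℕ => 1 - P.a k) =Θ[atTop] (fun k : ℕ => (k : ℝ) ^ (-γ)) →
        (fun k : ℕ => P.rho k) =Θ[atTop] (fun k : ℕ => (k : ℝ) ^ (-γ)))) ∧
    -- (v)
    (∀ β : ℝ, 0 < β → Tendsto P.betaProd atTop (𝓝 β) →
      (∀ s : ℤ, ∀ᵐ u ∂uniformSeqLaw, P.tau u s ⊤ ≠ ⊥) ∧
      (∀ (s : ℤ) (u v : ℤ → Set.Ico (0 : ℝ) 1),
        (∀ k : ℤ, P.tau u s ⊤ ≤ (k : WithBot ℤ) → v k = u k) →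
        ∀ i : ℤ, s ≤ i → P.Phi e g₀ u i = P.Phi e g₀ v i) ∧
      Summable P.rho ∧
      (∀ (s : ℤ) (m : ℕ),
        uniformSeqLaw.real {u | P.tau u s ⊤ < ((s - m : ℤ) : WithBot ℤ)}
          ≤ ∑' i : ℕ, P.rho (m + i))) := by
  have : Nonempty G := ⟨g₀⟩
  have hpos := P.a_pos hβ
  refine ⟨fun s t _ => P.ae_tau_coe_ne_bot hβ s t, ⟨P.measurable_Phi e g₀,
    P.compatible_map_Phi e g₀ (P.a_tendsto_one hβ) fun i => P.ae_tau_coe_ne_bot hβ i i,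
    P.isStationaryLaw_map_Phi e g₀⟩, ?_, ⟨fun s t _ m => P.uniformSeqLaw_real_tau_lt m, ?_, ?_⟩, ?_⟩
  · intro s t _ u v h i hs ht
    exact P.Phi_congr e g₀ (fun k hk hkt => h k hk (WithTop.coe_le_coe.1 hkt)) hs
      (WithTop.coe_le_coe.2 ht)
  · rintro ⟨C, r, hr0, hr1, h⟩
    exact returnProb_le_geometric P.a_le_one hpos hr0 hr1 h
  · intro γ hγ h
    exact returnProb_isTheta P.a_le_one hpos hγ h
  · intro β hβ0 hlim
    have hanti : Antitone P.betaProd := antitone_nat_of_succ_le fun n => by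
      rw [P.betaProd_eq, P.betaProd_eq, climbProb_succ]
      exact mul_le_of_le_one_right (climbProb_nonneg P.a_nonneg _) (P.a_le_one _)
    -- The minimum with `1` accounts for the empty product `climbProb P.a 0`, which is not one of
    -- the `β_m`.
    have hle : ∀ k, min 1 β ≤ climbProb P.a k := fun k => by
      rcases k with _ | k
      · simp [climbProb]
      · exact (min_le_right _ _).trans (hanti.le_of_tendsto hlim k)
    have hρ : Summable P.rho :=
      summable_returnProb P.a_nonneg P.a_le_one (lt_min one_pos hβ0) hle
    exact ⟨P.ae_tau_top_ne_bot hρ, fun s u v h i hs =>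
      P.Phi_congr e g₀ (fun k hk _ => h k hk) hs le_top, hρ,
      fun s m => P.uniformSeqLaw_real_tau_top_lt hρ m⟩
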